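/- Let $A$ be a (not necessarily commutative) unital ring, $(\mathcal C,\Delta,\varepsilon)$ an $A$-coring and $\mathbf x\in\mathcal C$ a group-like element ($\Delta(\mathbf x)=\mathbf x\otimes_A\mathbf x$, $\varepsilon(\mathbf x)=1_A$). Write $\mathcal M^{\mathcal C}$ for the category of right $\mathcal C$-comodules $(M,\varrho_M)$ and $\mathrm{Hom}^{\mathcal C}$ for colinear maps; $A$ is a right $\mathcal C$-comodule by $A\to A\otimes_A\mathcal C\simeq\mathcal C$, $a\mapsto\mathbf x a$. Let ${}^*\mathcal C=\mathrm{Hom}_{A-}(\mathcal C,A)$ be the left dual ring, with product $(f\cdot g)(c)=\sum g(c_1f(c_2))$ and unit $\varepsilon$; $A$ is a right ${}^*\mathcal C$-module by $a\leftharpoonup g=g(\mathbf x a)$. Put $$B=\{b\in A\mid b\mathbf x=\mathbf x b\},\qquad Q=\{q\in{}^*\mathcal C\mid \textstyle\sum c_1q(c_2)=q(c)\mathbf x\ \text{ for all } c\in\mathcal C\}.$$ $B$ is a subring of $A$, $A$ is a $(B,{}^*\mathcal C)$-bimodule and $Q$ is a $({}^*\mathcal C,B)$-bimodule, $Q$ being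 a left ideal of ${}^*\mathcal C$ with $(qb)(c)=q(c)b$. For $M\in\mathcal M^{\mathcal C}$ let $M^{co\mathcal C}=\{m\in M\mid\varrho_M(m)=m\otimes_A\mathbf x\}$, a right $B$-module, and consider $$\Psi_M: M^{co\mathcal C}\otimes_BA\to M,\ m\otimes a\mapsto ma,\qquad \Psi'_M:\mathrm{Hom}^{\mathcal C}(A,M)\otimes_BA\to M,\ f\otimes a\mapsto f(a).$$ $\mathcal M^{\mathcal C}$ satisfies the *weak structure theorem* if $\Psi_M$ is bijective for all $M\in\mathcal M^{\mathcal C}$. The extension $A/B$ is *$\mathcal C$-Galois* if $\beta:A\otimes_BA\to\mathcal C$, $\tilde a\otimes a\mapsto\tilde a\mathbf x a$, is bijective. An object is *$A$-generated* if it is an epimorphic image of a direct sum of copies of $A$; $\mathrm{Gen}(A_{{}^*\mathcal C})$ is the class of $A$-generated right ${}^*\mathcal C$-modules, and $\sigma[A_{{}^*\mathcal C}]$ that of the right ${}^*\mathcal C$-modules that embed in an $A$-generated one. **Theorem.** Assume that ${}_A\mathcal C$ is finitely generated and projective. Then the following are equivalent: 1. $\mathcal M^{\mathcal C}$ satisfies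 the weak structure theorem; 2. ${}_BA$ is flat and $A/B$ is $\mathcal C$-Galois; 3. ${}_BA$ is flat and $\Psi'_{\mathcal C}$ is an isomorphism; 4. ${}_BA$ is flat, $\mathcal M_{{}^*\mathcal C}=\sigma[A_{{}^*\mathcal C}]$, and $\Psi'_M$ is bijective for every $A$-generated $M\in\mathcal M^{\mathcal C}$; 5. $\Psi'_M$ is bijective for every $M\in\mathcal M^{\mathcal C}$; 6. ${}_BA$ is flat, $\mathcal M_{{}^*\mathcal C}=\sigma[A_{{}^*\mathcal C}]$, and $\mathrm{Hom}_{-{}^*\mathcal C}(A,-):\mathrm{Gen}(A_{{}^*\mathcal C})\to\mathcal M_B$ is full and faithful; 7. $\mathrm{Hom}_{-{}^*\mathcal C}(A,-):\mathcal M_{{}^*\mathcal C}\to\mathcal M_B$ is faithful; 8. $A_{{}^*\mathcal C}$ is a generator; 9. $F:Q\otimes_BA\to{}^*\mathcal C$, $q\otimes a\mapsto[c\mapsto q(c)a]$, is surjective; equivalently, $F$ is bijective; 10. $Q_B$ is finitely generated and projective, $\Omega:A\to\mathrm{Hom}_{-B}(Q,B)$, $a\mapsto[q\mapsto a\leftharpoonup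 q]$, is an isomorphism of $(B,{}^*\mathcal C)$-bimodules, and ${}_{{}^*\mathcal C}Q$ is faithful; 11. ${}_BA$ is finitely generated and projective, and $\Lambda:{}^*\mathcal C\to\mathrm{End}({}_BA)^{op}$, $g\mapsto[a\mapsto a\leftharpoonup g]$, is a ring isomorphism. -/

import Mathlib

universe u

open MulOpposite

namespace CoringTheory

/-! ## Balanced tensor products over a noncommutative ring

Right `R`-modules are modules over `Rᵐᵒᵖ`. -/

section BalTensor

variable (R : Type*) [Ring R]

/-- The relations `m r ⊗ n = m ⊗ r n`. -/
def balRel (M N : Type*) [AddCommGroup M] [Module Rᵐᵒᵖ M] [AddCommGroup N] [Module R N] :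
    AddSubgroup (TensorProduct ℤ M N) :=
  AddSubgroup.closure {t | ∃ (m : M) (r : R) (n : N),
    t = TensorProduct.tmul ℤ (op r • m) n - TensorProduct.tmul ℤ m (r • n)}

/-- The tensor product `M ⊗_R N` of a right and a left `R`-module. -/
def BalTensor (M N : Type*) [AddCommGroup M] [Module Rᵐᵒᵖ M] [AddCommGroup N] [Module R N] :
    Type _ :=
  TensorProduct ℤ M N ⧸ balRel R M N

namespace BalTensor

section Basic

variable {M N P : Type*} [AddCommGroup M] [Module Rᵐᵒᵖ M] [AddCommGroup N] [Module R N]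
  [AddCommGroup P]

instance instAddCommGroup : AddCommGroup (BalTensor R M N) :=
  inferInstanceAs (AddCommGroup (TensorProduct ℤ M N ⧸ balRel R M N))

/-- The quotient map `M ⊗_ℤ N → M ⊗_R N`. -/
def mk (M N : Type*) [AddCommGroup M] [Module Rᵐᵒᵖ M] [AddCommGroup N] [Module R N] :
    TensorProduct ℤ M N →+ BalTensor R M N :=
  QuotientAddGroup.mk' (balRel R M N)

/-- The pure tensor `m ⊗ n`. -/
def tmul (m : M) (n : N) : BalTensor R M N := mk R M N (TensorProduct.tmul ℤ m n)

theorem tmul_add (m : M) (n n' : N) : tmul R m (n + n') = tmul R m n + tmul R m n' := by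
  rw [tmul, TensorProduct.tmul_add, map_add]; rfl

theorem add_tmul (m m' : M) (n : N) : tmul R (m + m') n = tmul R m n + tmul R m' n := by
  rw [tmul, TensorProduct.add_tmul, map_add]; rfl

theorem zero_tmul (n : N) : tmul R (0 : M) n = 0 := by
  rw [tmul, TensorProduct.zero_tmul, map_zero]

theorem tmul_zero (m : M) : tmul R m (0 : N) = 0 := by
  rw [tmul, TensorProduct.tmul_zero, map_zero]

theorem smul_tmul (m : M) (r : R) (n : N) : tmul R (op r • m) n = tmul R m (r • n) := by
  rw [← sub_eq_zero, tmul, tmul, ← map_sub]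
  exact (QuotientAddGroup.eq_zero_iff _).2 (AddSubgroup.subset_closure ⟨m, r, n, rfl⟩)

variable {R} in
/-- The additive map out of `M ⊗_R N` given by an `R`-balanced biadditive map. -/
def lift (f : M →+ N →+ P) (hf : ∀ (m : M) (r : R) (n : N), f (op r • m) n = f m (r • n)) :
    BalTensor R M N →+ P :=
  QuotientAddGroup.lift (balRel R M N)
    (TensorProduct.liftAddHom f (fun z m n => by simp))
    (by
      unfold balRel
      rw [AddSubgroup.closure_le]
      rintro t ⟨m, r, n, rfl⟩
      simp [hf])

@[simp] theorem lift_tmul (f : M →+ N →+ P)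
    (hf : ∀ (m : M) (r : R) (n : N), f (op r • m) n = f m (r • n)) (m : M) (n : N) :
    lift f hf (tmul R m n) = f m n := rfl

variable {R} in
@[elab_as_elim] theorem induction_on {p : BalTensor R M N → Prop} (t : BalTensor R M N)
    (tm : ∀ m n, p (tmul R m n)) (add : ∀ s t, p s → p t → p (s + t)) : p t := by
  obtain ⟨t, rfl⟩ : ∃ t', mk R M N t' = t := QuotientAddGroup.mk'_surjective (balRel R M N) t
  induction t with
  | zero => exact tm 0 0 |> fun h => by rwa [tmul, TensorProduct.tmul_zero] at h
  | tmul m n => exact tm m n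
  | add s t hs ht => rw [map_add]; exact add _ _ hs ht

variable {R} in
theorem hom_ext {f g : BalTensor R M N →+ P} (h : ∀ m n, f (tmul R m n) = g (tmul R m n)) :
    f = g := by
  ext t
  induction t using induction_on with
  | tm m n => exact h m n
  | add s t hs ht => rw [map_add, map_add, hs, ht]

end Basic

section Map

variable {M N M' N' : Type*} [AddCommGroup M] [Module Rᵐᵒᵖ M] [AddCommGroup N] [Module R N]
  [AddCommGroup M'] [Module Rᵐᵒᵖ M'] [AddCommGroup N'] [Module R N']

variable {R} in
/-- The map `f ⊗ g`. -/
def map (f : M →ₗ[Rᵐᵒᵖ] M') (g : N →ₗ[R] N') : BalTensor R M N →+ BalTensor R M' N' :=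
  lift
    (AddMonoidHom.mk' (fun m => AddMonoidHom.mk' (fun n => tmul R (f m) (g n))
        (fun n n' => by simp [tmul_add]))
      (fun m m' => by ext n; simp [add_tmul]))
    (fun m r n => by simp [smul_tmul])

@[simp] theorem map_tmul (f : M →ₗ[Rᵐᵒᵖ] M') (g : N →ₗ[R] N') (m : M) (n : N) :
    map f g (tmul R m n) = tmul R (f m) (g n) := rfl

end Map

section Actions

variable {M N : Type*} [AddCommGroup M] [Module Rᵐᵒᵖ M] [AddCommGroup N] [Module R N]
variable {S : Type*} [Ring S]

/-- If `M` is an `(S, R)`-bimodule, `M ⊗_R N` is a left `S`-module: `s (m ⊗ n) = s m ⊗ n`. -/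
instance instLeftModule [Module S M] [SMulCommClass S Rᵐᵒᵖ M] : Module S (BalTensor R M N) where
  smul s := map (R := R)
    { toFun := fun m => s • m, map_add' := smul_add s, map_smul' := fun r m => smul_comm s r m }
    LinearMap.id
  one_smul t := by
    change map (R := R) _ _ t = t
    induction t using induction_on with
    | tm m n => simp
    | add s t hs ht => rw [map_add, hs, ht]
  mul_smul a b t := by
    change map (R := R) _ _ t = map (R := R) _ _ (map (R := R) _ _ t)
    induction t using induction_on with
    | tm m n => simp [mul_smul]
    | add s t hs ht => rw [map_add, map_add, map_add, hs, ht]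
  smul_zero a := map_zero _
  smul_add a := map_add _
  add_smul a b t := by
    change map (R := R) _ _ t = map (R := R) _ _ t + map (R := R) _ _ t
    induction t using induction_on with
    | tm m n => simp [add_smul, add_tmul]
    | add s t hs ht => rw [map_add, map_add, map_add, hs, ht]; abel
  zero_smul t := by
    change map (R := R) _ _ t = 0
    induction t using induction_on with
    | tm m n => simp [zero_tmul]
    | add s t hs ht => rw [map_add, hs, ht, add_zero]

@[simp] theorem smul_tmul_left [Module S M] [SMulCommClass S Rᵐᵒᵖ M] (s : S) (m : M) (n : N) :
    s • tmul R m n = tmul R (s • m) n := rfl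

/-- If `N` is an `(R, S)`-bimodule, `M ⊗_R N` is a right `S`-module: `(m ⊗ n) s = m ⊗ n s`. -/
instance instRightModule [Module Sᵐᵒᵖ N] [SMulCommClass R Sᵐᵒᵖ N] :
    Module Sᵐᵒᵖ (BalTensor R M N) where
  smul s := map (R := R) LinearMap.id
    { toFun := fun n => s • n, map_add' := smul_add s,
      map_smul' := fun r n => (smul_comm r s n).symm }
  one_smul t := by
    change map (R := R) _ _ t = t
    induction t using induction_on with
    | tm m n => simp
    | add s t hs ht => rw [map_add, hs, ht]
  mul_smul a b t := by
    change map (R := R) _ _ t = map (R := R) _ _ (map (R := R) _ _ t)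
    induction t using induction_on with
    | tm m n => simp [mul_smul]
    | add s t hs ht => rw [map_add, map_add, map_add, hs, ht]
  smul_zero a := map_zero _
  smul_add a := map_add _
  add_smul a b t := by
    change map (R := R) _ _ t = map (R := R) _ _ t + map (R := R) _ _ t
    induction t using induction_on with
    | tm m n => simp [add_smul, tmul_add]
    | add s t hs ht => rw [map_add, map_add, map_add, hs, ht]; abel
  zero_smul t := by
    change map (R := R) _ _ t = 0
    induction t using induction_on with
    | tm m n => simp [tmul_zero]
    | add s t hs ht => rw [map_add, hs, ht, add_zero]

@[simp] theorem smul_tmul_right [Module Sᵐᵒᵖ N] [SMulCommClass R Sᵐᵒᵖ N] (s : Sᵐᵒᵖ) (m : M)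
    (n : N) : s • tmul R m n = tmul R m (s • n) := rfl

end Actions

section Assoc

section

variable {M N P : Type*} {S : Type*} [Ring S] [AddCommGroup M] [Module Rᵐᵒᵖ M]
  [AddCommGroup N] [Module R N] [Module Sᵐᵒᵖ N] [SMulCommClass R Sᵐᵒᵖ N]
  [AddCommGroup P] [Module S P]

variable {R} in
/-- For fixed `p`, the map `m ⊗ n ↦ m ⊗ (n ⊗ p)`. -/
def assocAux (p : P) : BalTensor R M N →+ BalTensor R M (BalTensor S N P) :=
  lift
    (AddMonoidHom.mk' (fun m => AddMonoidHom.mk' (fun n => tmul R m (tmul S n p))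
        (fun n n' => by rw [add_tmul, tmul_add]))
      (fun m m' => by ext n; exact add_tmul R m m' _))
    (fun m r n => smul_tmul R m r (tmul S n p))

theorem assocAux_tmul (p : P) (m : M) (n : N) :
    assocAux (R := R) (S := S) p (tmul R m n) = tmul R m (tmul S n p) := rfl

theorem assocAux_add (p p' : P) :
    assocAux (R := R) (M := M) (N := N) (S := S) (p + p') =
      assocAux (R := R) (S := S) p + assocAux (R := R) (S := S) p' :=
  hom_ext fun m n => by
    rw [AddMonoidHom.add_apply, assocAux_tmul, assocAux_tmul, assocAux_tmul, tmul_add, tmul_add]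

theorem assocAux_smul (t : BalTensor R M N) (s : S) (p : P) :
    assocAux (R := R) (S := S) p (op s • t) = assocAux (R := R) (S := S) (s • p) t := by
  induction t using induction_on with
  | tm m n => rw [smul_tmul_right, assocAux_tmul, assocAux_tmul, smul_tmul]
  | add t t' h h' => rw [smul_add, map_add, map_add, h, h']

variable {R} in
/-- The associativity isomorphism `(M ⊗_R N) ⊗_S P → M ⊗_R (N ⊗_S P)`, as an additive map. -/
def assoc : BalTensor S (BalTensor R M N) P →+ BalTensor R M (BalTensor S N P) :=
  lift (AddMonoidHom.flip (AddMonoidHom.mk' (fun p => assocAux (R := R) (S := S) p)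
    (fun p p' => assocAux_add R p p'))) (fun t s p => assocAux_smul R t s p)

theorem assoc_tmul (t : BalTensor R M N) (p : P) :
    assoc (R := R) (S := S) (tmul S t p) = assocAux (R := R) (S := S) p t := rfl

end

end Assoc

section Contract

variable {M N : Type*} [AddCommGroup M] [Module Rᵐᵒᵖ M] [AddCommGroup N] [Module R N]

variable {R} in
/-- `m ⊗ n ↦ f(m) n` for a right linear form `f` on `M`. -/
def lcontract (f : M →+ R) (hf : ∀ (r : R) (m : M), f (op r • m) = f m * r) :
    BalTensor R M N →+ N :=
  lift (AddMonoidHom.mk' (fun m => AddMonoidHom.mk' (fun n => f m • n) (smul_add _))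
      (fun m m' => by ext n; simp [add_smul]))
    (fun m r n => by simp [hf, mul_smul])

variable {R} in
/-- `m ⊗ n ↦ m g(n)` for a left linear form `g` on `N`. -/
def rcontract (g : N →ₗ[R] R) : BalTensor R M N →+ M :=
  lift (AddMonoidHom.mk' (fun m => AddMonoidHom.mk' (fun n => op (g n) • m)
        (fun n n' => by simp [add_smul]))
      (fun m m' => by ext n; simp))
    (fun m r n => by simp [mul_smul])

theorem rcontract_tmul (g : N →ₗ[R] R) (m : M) (n : N) :
    rcontract g (tmul R m n) = op (g n) • m := rfl

theorem rcontract_smul {S : Type*} [Ring S] [Module S M] [SMulCommClass S Rᵐᵒᵖ M]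
    (g : N →ₗ[R] R) (s : S) (t : BalTensor R M N) : rcontract g (s • t) = s • rcontract g t := by
  induction t using induction_on with
  | tm m n => rw [smul_tmul_left, rcontract_tmul, rcontract_tmul, (smul_comm s (op (g n)) m).symm]
  | add t t' h h' => rw [smul_add, map_add, map_add, smul_add, h, h']

variable {R} in
/-- `rcontract g` as a left linear map, when `M` is a bimodule. -/
def rcontractₗ {S : Type*} [Ring S] [Module S M] [SMulCommClass S Rᵐᵒᵖ M]
    (g : N →ₗ[R] R) : BalTensor R M N →ₗ[S] M where
  toFun := rcontract g
  map_add' := map_add _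
  map_smul' := rcontract_smul R g

end Contract

end BalTensor

/-- A left `R`-module `N` is flat: `- ⊗_R N` preserves injectivity of maps of right modules. -/
def IsFlat (R N : Type u) [Ring R] [AddCommGroup N] [Module R N] : Prop :=
  ∀ (M M' : Type u) [AddCommGroup M] [Module Rᵐᵒᵖ M] [AddCommGroup M'] [Module Rᵐᵒᵖ M']
    (f : M →ₗ[Rᵐᵒᵖ] M'), Function.Injective f →
      Function.Injective (BalTensor.map (R := R) f (LinearMap.id : N →ₗ[R] N))

end BalTensor

/-! ## Generated and subgenerated modules -/

section Generators

variable (S P : Type u) [Ring S] [AddCommGroup P] [Module S P]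

/-- `M` is `P`-generated: an epimorphic image of a direct sum of copies of `P`. -/
def IsGenerated (M : Type u) [AddCommGroup M] [Module S M] : Prop :=
  ∃ (I : Type u) (f : (I →₀ P) →ₗ[S] M), Function.Surjective f

/-- `M` is `P`-subgenerated: it embeds in a `P`-generated module. -/
def IsSubgenerated (M : Type u) [AddCommGroup M] [Module S M] : Prop :=
  ∃ (N : Type u) (_ : AddCommGroup N) (_ : Module S N),
    IsGenerated S P N ∧ ∃ f : M →ₗ[S] N, Function.Injective f

/-- `P` is a generator: every module is `P`-generated. -/
def IsGenerator : Prop :=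
  ∀ (M : Type u) [AddCommGroup M] [Module S M], IsGenerated S P M

/-- `P` is a subgenerator: every module is `P`-subgenerated. -/
def IsSubgenerator : Prop :=
  ∀ (M : Type u) [AddCommGroup M] [Module S M], IsSubgenerated S P M

end Generators

/-! ## Corings and comodules -/

section Coring

variable (A C : Type u) [Ring A] [AddCommGroup C] [Module A C] [Module Aᵐᵒᵖ C]
  [SMulCommClass A Aᵐᵒᵖ C]

/-- The structure of an `A`-coring on an `A`-bimodule `C`. -/
class Coring where
  /-- comultiplication -/
  comul : C →+ BalTensor A C C
  /-- counit -/
  counit : C →+ A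
  comul_smul : ∀ (a : A) (c : C), comul (a • c) = a • comul c
  comul_op_smul : ∀ (a : Aᵐᵒᵖ) (c : C), comul (a • c) = a • comul c
  counit_smul : ∀ (a : A) (c : C), counit (a • c) = a * counit c
  counit_op_smul : ∀ (a : A) (c : C), counit (op a • c) = counit c * a
  /-- `(Δ ⊗ id) Δ = (id ⊗ Δ) Δ` -/
  coassoc : ∀ c : C,
    BalTensor.assoc (BalTensor.map (R := A)
        (⟨⟨comul, map_add comul⟩, comul_op_smul⟩ : C →ₗ[Aᵐᵒᵖ] BalTensor A C C)
        LinearMap.id (comul c)) =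
      BalTensor.map (R := A) LinearMap.id
        (⟨⟨comul, map_add comul⟩, comul_smul⟩ : C →ₗ[A] BalTensor A C C) (comul c)
  /-- `∑ ε(c₁) c₂ = c` -/
  counit_comul : ∀ c : C, BalTensor.lcontract counit counit_op_smul (comul c) = c
  /-- `∑ c₁ ε(c₂) = c` -/
  comul_counit : ∀ c : C,
    BalTensor.rcontract (⟨⟨counit, map_add counit⟩, counit_smul⟩ : C →ₗ[A] A) (comul c) = c

variable [Coring A C]

namespace Coring

/-- The comultiplication as a left linear map. -/
def comulₗ : C →ₗ[A] BalTensor A C C := ⟨⟨comul, map_add comul⟩, comul_smul⟩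

/-- The comultiplication as a right linear map. -/
def comulᵣ : C →ₗ[Aᵐᵒᵖ] BalTensor A C C := ⟨⟨comul, map_add comul⟩, comul_op_smul⟩

/-- The counit as a left linear map. -/
def counitₗ : C →ₗ[A] A := ⟨⟨counit, map_add counit⟩, counit_smul⟩

end Coring

/-- A right `C`-comodule structure on a right `A`-module `M`. -/
class RightComodule (M : Type u) [AddCommGroup M] [Module Aᵐᵒᵖ M] where
  /-- coaction -/
  coact : M →ₗ[Aᵐᵒᵖ] BalTensor A M C
  /-- `(ρ ⊗ id) ρ = (id ⊗ Δ) ρ` -/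
  coassoc : ∀ m : M,
    BalTensor.assoc (BalTensor.map (R := A) coact LinearMap.id (coact m)) =
      BalTensor.map (R := A) LinearMap.id (Coring.comulₗ A C) (coact m)
  /-- `∑ m₀ ε(m₁) = m` -/
  counit : ∀ m : M, BalTensor.rcontract (Coring.counitₗ A C) (coact m) = m

/-- `C` is a right comodule over itself. -/
instance instRightComoduleSelf : RightComodule A C C where
  coact := Coring.comulᵣ A C
  coassoc := Coring.coassoc
  counit := Coring.comul_counit

/-- The colinear maps `Hom^C(M, N)`. -/
def ColinearHom (M N : Type u) [AddCommGroup M] [Module Aᵐᵒᵖ M] [RightComodule A C M]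
    [AddCommGroup N] [Module Aᵐᵒᵖ N] [RightComodule A C N] : AddSubgroup (M →ₗ[Aᵐᵒᵖ] N) where
  carrier := {f | ∀ m : M, RightComodule.coact (A := A) (C := C) (f m) =
    BalTensor.map (R := A) f LinearMap.id (RightComodule.coact (A := A) (C := C) m)}
  zero_mem' m := by
    have h : BalTensor.map (R := A) (0 : M →ₗ[Aᵐᵒᵖ] N) (LinearMap.id : C →ₗ[A] C) = 0 := by
      exact BalTensor.hom_ext fun m c => BalTensor.zero_tmul A c
    rw [h]; simp
  add_mem' {f g} hf hg m := by
    have h : BalTensor.map (R := A) (f + g) (LinearMap.id : C →ₗ[A] C) =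
        BalTensor.map (R := A) f LinearMap.id + BalTensor.map (R := A) g LinearMap.id :=
      BalTensor.hom_ext fun m c => by simp [BalTensor.add_tmul]
    rw [h, LinearMap.add_apply, map_add, hf m, hg m, AddMonoidHom.add_apply]
  neg_mem' {f} hf m := by
    have h : BalTensor.map (R := A) (-f) (LinearMap.id : C →ₗ[A] C) =
        -BalTensor.map (R := A) f LinearMap.id :=
      BalTensor.hom_ext fun m c => by
        rw [AddMonoidHom.neg_apply, eq_neg_iff_add_eq_zero, BalTensor.map_tmul,
          BalTensor.map_tmul, LinearMap.neg_apply, ← BalTensor.add_tmul, neg_add_cancel,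
          BalTensor.zero_tmul]
    rw [h, LinearMap.neg_apply, map_neg, hf m, AddMonoidHom.neg_apply]

/-! ## The left dual ring -/

/-- The left dual `*C = Hom_A(C, A)` of left `A`-linear maps. -/
def LeftDual : Type u := C →ₗ[A] A

namespace LeftDual

variable {A C}

instance instAddCommGroup : AddCommGroup (LeftDual A C) :=
  inferInstanceAs (AddCommGroup (C →ₗ[A] A))

/-- An element of `*C` as a linear map. -/
def toLin : LeftDual A C ≃+ (C →ₗ[A] A) := AddEquiv.refl _

instance instCoeFun : CoeFun (LeftDual A C) (fun _ => C → A) := ⟨fun f => toLin f⟩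

theorem ext {f g : LeftDual A C} (h : ∀ c, f c = g c) : f = g :=
  toLin.injective (LinearMap.ext h)

theorem add_apply (f g : LeftDual A C) (c : C) : (f + g) c = f c + g c := rfl

/-- The left `A`-linear map `c ↦ ∑ c₁ f(c₂)`. -/
def contract (f : LeftDual A C) : C →ₗ[A] C :=
  (BalTensor.rcontractₗ (toLin f)).comp (Coring.comulₗ A C)

theorem contract_apply (f : LeftDual A C) (c : C) :
    contract f c = BalTensor.rcontract (toLin f) (Coring.comul c) := rfl

theorem contract_add (f g : LeftDual A C) : contract (f + g) = contract f + contract g := by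
  have key : ∀ t : BalTensor A C C, BalTensor.rcontract (toLin (f + g)) t =
      BalTensor.rcontract (toLin f) t + BalTensor.rcontract (toLin g) t := by
    intro t
    induction t using BalTensor.induction_on with
    | tm m n =>
      rw [BalTensor.rcontract_tmul, BalTensor.rcontract_tmul, BalTensor.rcontract_tmul, map_add,
        LinearMap.add_apply, op_add, add_smul]
    | add s t hs ht =>
      rw [(BalTensor.rcontract (toLin (f + g))).map_add, hs, ht, map_add, map_add]; abel
  exact LinearMap.ext fun c => key _

/-- `(f · g)(c) = ∑ g(c₁ f(c₂))`. -/
instance instMul : Mul (LeftDual A C) := ⟨fun f g => toLin.symm ((toLin g).comp (contract f))⟩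

/-- The unit is the counit. -/
instance instOne : One (LeftDual A C) := ⟨toLin.symm (Coring.counitₗ A C)⟩

theorem mul_apply (f g : LeftDual A C) (c : C) : (f * g) c = g (contract f c) := rfl

theorem one_apply (c : C) : (1 : LeftDual A C) c = Coring.counit c := rfl

theorem contract_one (c : C) : contract (1 : LeftDual A C) c = c := Coring.comul_counit c

theorem contract_mul (f g : LeftDual A C) (c : C) :
    contract (f * g) c = contract g (contract f c) := by
  have key : ∀ t : BalTensor A C C,
      BalTensor.rcontract (toLin g) (Coring.comul (BalTensor.rcontract (toLin f) t)) =
      BalTensor.rcontract ((toLin g).comp (BalTensor.rcontractₗ (toLin f)))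
        (BalTensor.assoc (BalTensor.map (R := A) (Coring.comulᵣ A C)
          (LinearMap.id : C →ₗ[A] C) t)) := by
    intro t
    induction t using BalTensor.induction_on with
    | tm m n =>
      rw [BalTensor.rcontract_tmul, Coring.comul_op_smul, BalTensor.map_tmul]
      change _ = BalTensor.rcontract _ (BalTensor.assoc (BalTensor.tmul A (Coring.comul m) n))
      generalize (Coring.comul m : BalTensor A C C) = s
      induction s using BalTensor.induction_on with
      | tm p q => rfl
      | add s s' h h' => rw [smul_add, map_add, h, h', BalTensor.add_tmul, map_add, map_add]
    | add s t hs ht => simp only [map_add, hs, ht]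
  have h1 : ∀ t : BalTensor A C C,
      BalTensor.rcontract (toLin (f * g)) t =
      BalTensor.rcontract ((toLin g).comp (BalTensor.rcontractₗ (toLin f)))
        (BalTensor.map (R := A) LinearMap.id (Coring.comulₗ A C) t) := by
    intro t
    induction t using BalTensor.induction_on with
    | tm m n => rfl
    | add s t hs ht => simp only [map_add, hs, ht]
  rw [contract_apply, contract_apply, contract_apply, key, h1]
  congr 1
  exact (Coring.coassoc c).symm

instance instRing : Ring (LeftDual A C) :=
  { instAddCommGroup, instMul, instOne with
    left_distrib := fun f g h => ext fun c => rfl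
    right_distrib := fun f g h => ext fun c => by
      rw [mul_apply, contract_add, add_apply, mul_apply, mul_apply, LinearMap.add_apply, map_add]
    zero_mul := fun f => ext fun c => by
      have h : contract (0 : LeftDual A C) = 0 := by
        have := contract_add (0 : LeftDual A C) 0
        rwa [add_zero, left_eq_add] at this
      rw [mul_apply, h]
      exact map_zero (toLin f)
    mul_zero := fun f => ext fun c => rfl
    mul_assoc := fun f g h => ext fun c => by
      rw [mul_apply, mul_apply, mul_apply, contract_mul]
    one_mul := fun f => ext fun c => by rw [mul_apply, contract_one]
    mul_one := fun f => ext fun c => by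
      rw [mul_apply, one_apply]
      have h : ∀ t : BalTensor A C C, Coring.counit (BalTensor.rcontract (toLin f) t) =
          f (BalTensor.lcontract Coring.counit Coring.counit_op_smul t) := by
        intro t
        induction t using BalTensor.induction_on with
        | tm m n =>
          rw [BalTensor.rcontract_tmul, Coring.counit_op_smul]
          exact ((toLin f).map_smul (Coring.counit m) n).symm
        | add s t hs ht => simp only [map_add, hs, ht]
      rw [contract_apply, h, Coring.counit_comul]
    neg_add_cancel := neg_add_cancel
    zsmul := fun n f => n • f
    zsmul_zero' := zero_smul ℤ
    zsmul_succ' := fun n f => by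
      simp [add_smul]
    zsmul_neg' := fun n f => by
      rw [Int.negSucc_eq, neg_smul]; norm_cast }

/-- `(f a)(c) = f(c) a`. -/
def mulRight (f : LeftDual A C) (a : A) : LeftDual A C :=
  toLin.symm
    { toFun := fun c => f c * a
      map_add' := fun c d => by rw [map_add, add_mul]
      map_smul' := fun r c => by rw [map_smul]; simp [mul_assoc] }

end LeftDual

/-! ## Group-like elements -/

/-- A group-like element of `C`. -/
structure GroupLikeElem where
  /-- the element -/
  val : C
  comul_val : Coring.comul val = BalTensor.tmul A val val
  counit_val : Coring.counit val = (1 : A)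

end Coring

section GroupLike

variable {A C : Type u} [Ring A] [AddCommGroup C] [Module A C] [Module Aᵐᵒᵖ C]
  [SMulCommClass A Aᵐᵒᵖ C] [Coring A C] (x : GroupLikeElem A C)

/-- The subring `B = {b ∈ A | b x = x b}` of coinvariants of `A`. -/
def coinvRing : Subring A where
  carrier := {b | b • x.val = op b • x.val}
  mul_mem' {a b} ha hb := by
    simp only [Set.mem_ofPred_eq] at *
    rw [mul_smul, hb, smul_comm, ha, op_mul, mul_smul]
  one_mem' := by simp
  add_mem' {a b} ha hb := by
    simp only [Set.mem_ofPred_eq] at *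
    rw [add_smul, ha, hb, op_add, add_smul]
  zero_mem' := by simp
  neg_mem' {a} ha := by
    simp only [Set.mem_ofPred_eq] at *
    rw [neg_smul, ha, op_neg, neg_smul]

theorem coinvRing_smul (b : coinvRing x) : (b : A) • x.val = op (b : A) • x.val := b.2

/-- A copy of `A`, carrying the module and comodule structures determined by `x`. -/
@[nolint unusedArguments]
def RegMod (_ : GroupLikeElem A C) : Type u := A

namespace RegMod

instance instAddCommGroup : AddCommGroup (RegMod x) := inferInstanceAs (AddCommGroup A)

variable {x} in
/-- The identity `A = A`. -/
def val : RegMod x ≃+ A := AddEquiv.refl A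

/-- `A` as a left `B`-module. -/
instance instModuleLeft : Module (coinvRing x) (RegMod x) where
  smul b a := val.symm (b * val a)
  one_smul a := one_mul (val a)
  mul_smul b b' a := mul_assoc (b : A) b' (val a)
  smul_zero b := mul_zero (b : A)
  smul_add b := mul_add (b : A)
  add_smul b b' a := add_mul (b : A) b' (val a)
  zero_smul a := zero_mul (val a)

/-- `A` as a right `B`-module. -/
instance instModuleRight : Module (coinvRing x)ᵐᵒᵖ (RegMod x) where
  smul b a := val.symm (val a * b.unop)
  one_smul a := mul_one (val a)
  mul_smul b b' a := (mul_assoc (val a) (b'.unop : A) b.unop).symm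
  smul_zero b := zero_mul (b.unop : A)
  smul_add b a a' := add_mul (val a) (val a') (b.unop : A)
  add_smul b b' a := mul_add (val a) (b.unop : A) b'.unop
  zero_smul a := mul_zero (val a)

/-- `A` as a right `A`-module. -/
instance instModuleOp : Module Aᵐᵒᵖ (RegMod x) := inferInstanceAs (Module Aᵐᵒᵖ A)

/-- `A` as a right `*C`-module: `a ↼ g = g(x a)`. -/
instance instModuleDual : Module (LeftDual A C)ᵐᵒᵖ (RegMod x) where
  smul g a := val.symm (g.unop (op (val a) • x.val))
  one_smul a := by
    change Coring.counit (op (val a) • x.val) = val a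
    rw [Coring.counit_op_smul, x.counit_val, one_mul]
  mul_smul g h a := by
    change (h.unop * g.unop) (op (val a) • x.val) =
      g.unop (op (h.unop (op (val a) • x.val)) • x.val)
    rw [LeftDual.mul_apply, LeftDual.contract_apply, Coring.comul_op_smul, x.comul_val]
    rfl
  smul_zero g := by
    change g.unop (op (0 : A) • x.val) = 0
    rw [op_zero, zero_smul, map_zero]
  smul_add g a b := by
    change g.unop (op (val a + val b) • x.val) =
      g.unop (op (val a) • x.val) + g.unop (op (val b) • x.val)
    rw [op_add, add_smul, map_add]
  add_smul g h a := rfl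
  zero_smul a := rfl

theorem left_smul_def (b : coinvRing x) (a : RegMod x) : val (b • a) = b * val a := rfl

theorem dual_smul_def (g : LeftDual A C) (a : RegMod x) :
    val (op g • a) = g (op (val a) • x.val) := rfl

theorem op_smul_def (r : A) (a : RegMod x) : val (op r • a) = val a * r := rfl

instance instSMulCommDual : SMulCommClass (coinvRing x) (LeftDual A C)ᵐᵒᵖ (RegMod x) where
  smul_comm b g a := by
    apply val.injective
    obtain ⟨g, rfl⟩ := op_surjective g
    rw [left_smul_def, dual_smul_def, dual_smul_def, left_smul_def, op_mul, mul_smul,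
      ← coinvRing_smul, ← smul_comm (b : A) (op (val a)) x.val, (LeftDual.toLin g).map_smul, smul_eq_mul]

instance instSMulCommOp : SMulCommClass (coinvRing x) Aᵐᵒᵖ (RegMod x) where
  smul_comm b r a := (mul_assoc (b : A) (val a) r.unop).symm

/-- The coaction `a ↦ 1 ⊗ x a`, i.e. `a ↦ x a` under `A ⊗_A C = C`. -/
instance instRightComodule : RightComodule A C (RegMod x) where
  coact :=
    { toFun := fun a => BalTensor.tmul A (val.symm 1 : RegMod x) (op (val a) • x.val)
      map_add' := fun a b => by rw [map_add, op_add, add_smul, BalTensor.tmul_add]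
      map_smul' := fun r a => by
        obtain ⟨r, rfl⟩ := op_surjective r
        rw [op_smul_def, op_mul, mul_smul]; rfl }
  coassoc a := by
    have h : Coring.comul (op (val a) • x.val) =
        BalTensor.tmul A x.val (op (val a) • x.val) := by
      rw [Coring.comul_op_smul, x.comul_val, BalTensor.smul_tmul_right]
    change _ = BalTensor.tmul A (val.symm 1 : RegMod x) (Coring.comul (op (val a) • x.val))
    rw [h]
    change BalTensor.tmul A (val.symm 1 : RegMod x)
      (BalTensor.tmul A (op (1 : A) • x.val) (op (val a) • x.val)) = _
    rw [op_one, one_smul]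
  counit a := by
    change (1 : A) * Coring.counit (op (val a) • x.val) = val a
    rw [Coring.counit_op_smul, x.counit_val, one_mul, one_mul]

/-- Left multiplication by `b ∈ B` as a right `A`-linear map. -/
def leftMul (b : coinvRing x) : RegMod x →ₗ[Aᵐᵒᵖ] RegMod x where
  toFun a := b • a
  map_add' := smul_add b
  map_smul' r a := smul_comm b r a

/-- Left multiplication by `b ∈ B` as a right `*C`-linear map. -/
def leftMulDual (b : coinvRing x) : RegMod x →ₗ[(LeftDual A C)ᵐᵒᵖ] RegMod x where
  toFun a := b • a
  map_add' := smul_add b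
  map_smul' g a := smul_comm b g a

end RegMod

/-- `β : A ⊗_B A → C`, `a ⊗ a' ↦ a x a'`. -/
def galoisMap : BalTensor (coinvRing x) (RegMod x) (RegMod x) →+ C :=
  BalTensor.lift
    (AddMonoidHom.mk' (fun a => AddMonoidHom.mk' (fun a' =>
          RegMod.val a • op (RegMod.val a') • x.val)
        (fun a' a'' => by rw [map_add, op_add, add_smul, smul_add]))
      (fun a b => by ext a'; simp [add_smul]))
    (fun a b a' => by
      change (RegMod.val a * (b : A)) • op (RegMod.val a') • x.val =
        RegMod.val a • op ((b : A) * RegMod.val a') • x.val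
      rw [mul_smul, smul_comm (b : A), coinvRing_smul, op_mul, mul_smul])

/-- The extension `A/B` is `C`-Galois: `β` is bijective. -/
def IsGaloisExt : Prop := Function.Bijective (galoisMap x)

section Comodule

variable (M : Type u) [AddCommGroup M] [Module Aᵐᵒᵖ M] [RightComodule A C M]

/-- The coinvariants `M^{co C} = {m | ρ(m) = m ⊗ x}`. -/
def Coinv : AddSubgroup M where
  carrier := {m | RightComodule.coact (A := A) (C := C) m = BalTensor.tmul A m x.val}
  zero_mem' := by simp [BalTensor.zero_tmul]
  add_mem' {m n} hm hn := by
    simp only [Set.mem_ofPred_eq] at *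
    rw [map_add, hm, hn, BalTensor.add_tmul]
  neg_mem' {m} hm := by
    simp only [Set.mem_ofPred_eq] at *
    rw [map_neg, hm, neg_eq_iff_add_eq_zero, ← BalTensor.add_tmul, add_neg_cancel,
      BalTensor.zero_tmul]

/-- `M^{co C}` is a right `B`-module. -/
instance instModuleCoinv : Module (coinvRing x)ᵐᵒᵖ (Coinv x M) where
  smul b m := ⟨op (b.unop : A) • (m : M), by
    change RightComodule.coact (A := A) (C := C) _ = _
    have hm : RightComodule.coact (A := A) (C := C) (m : M) = BalTensor.tmul A (m : M) x.val := m.2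
    rw [map_smul, hm, BalTensor.smul_tmul_right, ← coinvRing_smul, BalTensor.smul_tmul]⟩
  one_smul m := Subtype.ext (one_smul Aᵐᵒᵖ (m : M))
  mul_smul b b' m := Subtype.ext (mul_smul (op (b.unop : A)) (op (b'.unop : A)) (m : M))
  smul_zero b := Subtype.ext (smul_zero (op (b.unop : A)))
  smul_add b m n := Subtype.ext (smul_add (op (b.unop : A)) (m : M) n)
  add_smul b b' m := Subtype.ext (add_smul (op (b.unop : A)) (op (b'.unop : A)) (m : M))
  zero_smul m := Subtype.ext (zero_smul Aᵐᵒᵖ (m : M))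

/-- `Ψ_M : M^{co C} ⊗_B A → M`, `m ⊗ a ↦ m a`. -/
def Psi : BalTensor (coinvRing x) (Coinv x M) (RegMod x) →+ M :=
  BalTensor.lift
    (AddMonoidHom.mk' (fun m => AddMonoidHom.mk' (fun a => op (RegMod.val a) • (m : M))
        (fun a a' => by rw [map_add, op_add, add_smul]))
      (fun m n => by ext a; simp))
    (fun m b a => by
      change op (RegMod.val a) • op (b : A) • (m : M) = op ((b : A) * RegMod.val a) • (m : M)
      rw [op_mul, mul_smul])

/-- `Hom^C(A, M)` is a right `B`-module: `(f b)(a) = f(b a)`. -/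
instance instModuleColinearHom :
    Module (coinvRing x)ᵐᵒᵖ (ColinearHom A C (RegMod x) M) where
  smul b f := ⟨f.1.comp (RegMod.leftMul x b.unop), fun a => by
    have h : ∀ a, RightComodule.coact (A := A) (C := C) (f.1 a) =
        BalTensor.map (R := A) f.1 LinearMap.id (RightComodule.coact (A := A) (C := C) a) := f.2
    change RightComodule.coact (A := A) (C := C) (f.1 (b.unop • a)) =
      BalTensor.tmul A (f.1 (b.unop • RegMod.val.symm 1)) (op (RegMod.val a) • x.val)
    rw [h]
    change BalTensor.tmul A (f.1 (RegMod.val.symm 1)) (op ((b.unop : A) * RegMod.val a) • x.val) = _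
    have h1 : (b.unop • RegMod.val.symm 1 : RegMod x) =
        op (b.unop : A) • (RegMod.val.symm 1 : RegMod x) := by
      change (b.unop : A) * 1 = 1 * (b.unop : A)
      rw [one_mul, mul_one]
    rw [h1, map_smul, BalTensor.smul_tmul, op_mul, mul_smul, ← coinvRing_smul,
      ← smul_comm (b.unop : A) (op (RegMod.val a)) x.val]⟩
  one_smul f := Subtype.ext (LinearMap.ext fun a => congrArg f.1 (one_smul (coinvRing x) a))
  mul_smul b b' f := Subtype.ext (LinearMap.ext fun a =>
    congrArg f.1 (mul_smul b'.unop b.unop a))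
  smul_zero b := rfl
  smul_add b f g := rfl
  add_smul b b' f := Subtype.ext (LinearMap.ext fun a =>
    (congrArg f.1 (add_smul b.unop b'.unop a)).trans (map_add f.1 _ _))
  zero_smul f := Subtype.ext (LinearMap.ext fun a =>
    (congrArg f.1 (zero_smul (coinvRing x) a)).trans (map_zero f.1))

theorem colinearHom_smul_apply (b : coinvRing x) (f : ColinearHom A C (RegMod x) M)
    (a : RegMod x) : (op b • f).1 a = f.1 (b • a) := rfl

/-- `Ψ'_M : Hom^C(A, M) ⊗_B A → M`, `f ⊗ a ↦ f(a)`. -/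
def Psi' : BalTensor (coinvRing x) (ColinearHom A C (RegMod x) M) (RegMod x) →+ M :=
  BalTensor.lift
    (AddMonoidHom.mk' (fun f => f.1.toAddMonoidHom) (fun f g => by ext a; rfl))
    (fun f b a => colinearHom_smul_apply x M b f a)

/-- The comodule `M` is `A`-generated: some family of colinear maps `A → M` induces a surjection
from the direct sum of copies of `A` onto `M`. -/
def IsComoduleGenerated : Prop :=
  ∃ (I : Type u) (f : I → ColinearHom A C (RegMod x) M),
    ∀ m : M, ∃ a : I →₀ RegMod x, (a.sum fun i ai => (f i).1 ai) = m

end Comodule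

/-- The weak structure theorem for `M^C`. -/
def WeakStructureTheorem : Prop :=
  ∀ (M : Type u) [AddCommGroup M] [Module Aᵐᵒᵖ M] [RightComodule A C M],
    Function.Bijective (Psi x M)

/-! ## The functor `Hom_{-*C}(A, -)` -/

section HomFunctor

variable (M : Type u) [AddCommGroup M] [Module (LeftDual A C)ᵐᵒᵖ M]

/-- `Hom_{-*C}(A, M)`. -/
def DualHom : Type u := RegMod x →ₗ[(LeftDual A C)ᵐᵒᵖ] M

variable {M}

instance instAddCommGroupDualHom : AddCommGroup (DualHom x M) :=
  inferInstanceAs (AddCommGroup (RegMod x →ₗ[(LeftDual A C)ᵐᵒᵖ] M))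

variable {x} in
/-- An element of `Hom_{-*C}(A, M)` as a linear map. -/
def DualHom.lin : DualHom x M ≃+ (RegMod x →ₗ[(LeftDual A C)ᵐᵒᵖ] M) := AddEquiv.refl _

/-- `Hom_{-*C}(A, M)` is a right `B`-module: `(f b)(a) = f(b a)`. -/
instance instModuleDualHom : Module (coinvRing x)ᵐᵒᵖ (DualHom x M) where
  smul b f := DualHom.lin.symm ((DualHom.lin f).comp (RegMod.leftMulDual x b.unop))
  one_smul f := DualHom.lin.injective (LinearMap.ext fun a =>
    congrArg (DualHom.lin f) (one_smul (coinvRing x) a))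
  mul_smul b b' f := DualHom.lin.injective (LinearMap.ext fun a =>
    congrArg (DualHom.lin f) (mul_smul b'.unop b.unop a))
  smul_zero b := rfl
  smul_add b f g := rfl
  add_smul b b' f := DualHom.lin.injective (LinearMap.ext fun a =>
    (congrArg (DualHom.lin f) (add_smul b.unop b'.unop a)).trans (map_add (DualHom.lin f) _ _))
  zero_smul f := DualHom.lin.injective (LinearMap.ext fun a =>
    (congrArg (DualHom.lin f) (zero_smul (coinvRing x) a)).trans (map_zero (DualHom.lin f)))

/-- Composition with a right `*C`-linear map, as a right `B`-linear map. -/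
def DualHom.postcomp {N : Type u} [AddCommGroup N] [Module (LeftDual A C)ᵐᵒᵖ N]
    (φ : M →ₗ[(LeftDual A C)ᵐᵒᵖ] N) : DualHom x M →ₗ[(coinvRing x)ᵐᵒᵖ] DualHom x N where
  toFun f := DualHom.lin.symm (φ.comp (DualHom.lin f))
  map_add' f g := LinearMap.comp_add (DualHom.lin f) (DualHom.lin g) φ
  map_smul' b f := rfl

open CategoryTheory

/-- The functor `Hom_{-*C}(A, -)` from right `*C`-modules to right `B`-modules. -/
def homFunctor : ModuleCat.{u} (LeftDual A C)ᵐᵒᵖ ⥤ ModuleCat.{u} (coinvRing x)ᵐᵒᵖ where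
  obj M := ModuleCat.of (coinvRing x)ᵐᵒᵖ (DualHom x M)
  map φ := ModuleCat.ofHom (DualHom.postcomp x φ.hom)

/-- The class `Gen(A)` of `A`-generated right `*C`-modules. -/
def genProperty : ObjectProperty (ModuleCat.{u} (LeftDual A C)ᵐᵒᵖ) :=
  fun M => IsGenerated (LeftDual A C)ᵐᵒᵖ (RegMod x) M

/-- The restriction of `Hom_{-*C}(A, -)` to the full subcategory `Gen(A)`. -/
def genHomFunctor : (genProperty x).FullSubcategory ⥤ ModuleCat.{u} (coinvRing x)ᵐᵒᵖ :=
  (genProperty x).ι ⋙ homFunctor x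

end HomFunctor

/-! ## The Morita context -/

/-- The left ideal `Q = {q ∈ *C | ∑ c₁ q(c₂) = q(c) x for all c}` of `*C`. -/
def MoritaQ : Submodule (LeftDual A C) (LeftDual A C) where
  carrier := {q | ∀ c : C, LeftDual.contract q c = q c • x.val}
  zero_mem' c := by
    have h : LeftDual.contract (0 : LeftDual A C) = 0 := by
      have := LeftDual.contract_add (0 : LeftDual A C) 0
      rwa [add_zero, left_eq_add] at this
    rw [h]
    exact (zero_smul A x.val).symm
  add_mem' {p q} hp hq c := by
    rw [LeftDual.contract_add, LinearMap.add_apply, hp, hq, LeftDual.add_apply, add_smul]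
  smul_mem' g q hq c := by
    rw [smul_eq_mul, LeftDual.contract_mul, hq, LeftDual.mul_apply]

/-- `Q` is a right `B`-module: `(q b)(c) = q(c) b`. -/
instance instModuleMoritaQ : Module (coinvRing x)ᵐᵒᵖ (MoritaQ x) where
  smul b q := ⟨LeftDual.mulRight q.1 (b.unop : A), fun c => by
    have hq : LeftDual.contract q.1 c = q.1 c • x.val := q.2 c
    have key : ∀ t : BalTensor A C C,
        BalTensor.rcontract (LeftDual.toLin (LeftDual.mulRight q.1 (b.unop : A))) t =
        op (b.unop : A) • BalTensor.rcontract (LeftDual.toLin q.1) t := by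
      intro t
      induction t using BalTensor.induction_on with
      | tm m n =>
        rw [BalTensor.rcontract_tmul, BalTensor.rcontract_tmul, ← mul_smul, ← op_mul]
        rfl
      | add s t hs ht => rw [map_add, map_add, smul_add, hs, ht]
    rw [LeftDual.contract_apply, key, ← LeftDual.contract_apply, hq, ← smul_comm (q.1 c),
      ← coinvRing_smul, ← mul_smul]
    rfl⟩
  one_smul q := Subtype.ext (LeftDual.ext fun c => mul_one (q.1 c))
  mul_smul b b' q := Subtype.ext (LeftDual.ext fun c =>
    (mul_assoc (q.1 c) (b'.unop : A) (b.unop : A)).symm)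
  smul_zero b := Subtype.ext (LeftDual.ext fun c => zero_mul (b.unop : A))
  smul_add b p q := Subtype.ext (LeftDual.ext fun c => add_mul (p.1 c) (q.1 c) (b.unop : A))
  add_smul b b' q := Subtype.ext (LeftDual.ext fun c => mul_add (q.1 c) (b.unop : A) b'.unop)
  zero_smul q := Subtype.ext (LeftDual.ext fun c => mul_zero (q.1 c))

/-- `F : Q ⊗_B A → *C`, `q ⊗ a ↦ q a`, where `(q a)(c) = q(c) a`. -/
def moritaF : BalTensor (coinvRing x) (MoritaQ x) (RegMod x) →+ LeftDual A C :=
  BalTensor.lift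
    (AddMonoidHom.mk' (fun q => AddMonoidHom.mk' (fun a => LeftDual.mulRight q.1 (RegMod.val a))
        (fun a b => LeftDual.ext fun c => mul_add (q.1 c) (RegMod.val a) (RegMod.val b)))
      (fun p q => by
        ext a
        exact LeftDual.ext fun c => add_mul (p.1 c) (q.1 c) (RegMod.val a)))
    (fun q b a => LeftDual.ext fun c => mul_assoc (q.1 c) (b : A) (RegMod.val a))

/-- `G(a ⊗ q) = a ↼ q ∈ B`. -/
def moritaG (a : RegMod x) (q : MoritaQ x) : coinvRing x :=
  ⟨RegMod.val (op q.1 • a), by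
    have hq : LeftDual.contract q.1 (op (RegMod.val a) • x.val) =
      q.1 (op (RegMod.val a) • x.val) • x.val := q.2 _
    change RegMod.val (op q.1 • a) • x.val = op (RegMod.val (op q.1 • a)) • x.val
    rw [RegMod.dual_smul_def, ← hq, LeftDual.contract_apply, Coring.comul_op_smul, x.comul_val]
    rfl⟩

/-- `Ω : A → Hom_{-B}(Q, B)`, `a ↦ [q ↦ a ↼ q]`. -/
def Omega : RegMod x →+ (MoritaQ x →ₗ[(coinvRing x)ᵐᵒᵖ] coinvRing x) :=
  AddMonoidHom.mk' (fun a =>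
      { toFun := fun q => moritaG x a q
        map_add' := fun p q => Subtype.ext rfl
        map_smul' := fun b q => Subtype.ext rfl })
    (fun a b => by
      ext q
      exact congrArg RegMod.val (smul_add (op q.1) a b))

/-- `Ω` is an isomorphism of `(B, *C)`-bimodules, where `(b h g)(q) = b h(g q)` for
`h ∈ Hom_{-B}(Q, B)`. -/
def IsBimoduleIsoOmega : Prop :=
  Function.Bijective (Omega x) ∧
    (∀ (b : coinvRing x) (a : RegMod x) (q : MoritaQ x), Omega x (b • a) q = b * Omega x a q) ∧
    ∀ (g : LeftDual A C) (a : RegMod x) (q : MoritaQ x), Omega x (op g • a) q = Omega x a (g • q)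

/-- `Λ : *C → End(_B A)^op`, `g ↦ [a ↦ a ↼ g]`, a ring homomorphism. -/
def Lambda : LeftDual A C →+* (Module.End (coinvRing x) (RegMod x))ᵐᵒᵖ where
  toFun g := op
    { toFun := fun a => op g • a
      map_add' := smul_add _
      map_smul' := fun b a => (smul_comm b (op g) a).symm }
  map_one' := by
    apply unop_injective
    ext a
    exact one_smul (LeftDual A C)ᵐᵒᵖ a
  map_mul' f g := by
    apply unop_injective
    ext a
    exact mul_smul (op g) (op f) a
  map_zero' := by
    apply unop_injective
    ext a
    exact zero_smul (LeftDual A C)ᵐᵒᵖ a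
  map_add' f g := by
    apply unop_injective
    ext a
    exact add_smul (op f) (op g) a

end GroupLike

end CoringTheory

open CoringTheory

set_option linter.unusedSectionVars false

namespace CoringTheory

/-! ### Dual bases of finitely generated projective modules -/

section DualBasis

variable {R M : Type*} [Ring R] [AddCommGroup M] [Module R M]

/-! The pair (A, Q) is a Morita context between B and `*C`, and every condition is equivalent to a
single equation in `*C`: 1 = ∑ q_j a_j with q_j ∈ Q and a_j ∈ A. This equation says that F is
surjective, since the image of F is a right ideal.

Given the equation, one inserts it wherever a 1 can act. Acting on b ∈ A it gives b = ∑ (b ↼ q_j)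
a_j, a dual basis of A over B, so that A is flat. Multiplying p ∈ Q it gives p = ∑ q_j (a_j ↼ p), a
dual basis of Q over B. The same two formulas make F injective, and Λ and Ω bijective. In a
`*C`-module, m = ∑ (m q_j) a_j shows that A is a generator and reconstructs a linear map from its
effect on Hom(A, -). In a comodule, m ↦ ∑ m₀ q_j(m₁) ⊗ a_j inverts Ψ.

Conversely, each condition produces the equation. If A is a generator, 1 is a sum of values of
linear maps A → `*C`, and each of these is b ↦ q b with q ∈ Q (`moritaF_surjective_of_isGenerator`).
If Λ or Ω is bijective, dual basis functionals are realised by elements of Q or of A. In the flat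
Galois case Q is the kernel of a B-linear map δ on `*C`, hence Q ⊗ A is the kernel of δ ⊗ A, and β⁻¹
supplies an element of this kernel lying over 1 (`moritaF_surjective_of_isGaloisExt`).

The remaining conditions lead to the generator property. A finite dual basis of C turns `*C`-modules
into comodules (`AsComodule.rightComodule`), so the statements on Ψ' apply to all modules. When A is
only a subgenerator, flatness and injectivity of evaluation on generated modules suffice
(`isGenerator_of_injective_dualEval`). -/

theorem exists_dualBasis (R M : Type*) [Ring R] [AddCommGroup M] [Module R M]
    [Module.Finite R M] [Module.Projective R M] :
    ∃ (n : ℕ) (e : Fin n → M) (f : Fin n → M →ₗ[R] R), ∀ m, ∑ i, f i m • e i = m := by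
  obtain ⟨n, f, g, -, -, h⟩ := Module.Finite.exists_comp_eq_id_of_projective R M
  refine ⟨n, fun i => f (Pi.single i 1), fun i => (LinearMap.proj i).comp g, fun m => ?_⟩
  have h1 : f (g m) = m := LinearMap.congr_fun h m
  conv_rhs => rw [← h1, pi_eq_sum_univ' (g m), map_sum]
  refine Finset.sum_congr rfl fun i _ => ?_
  rw [map_smul]
  rfl

variable {ι : Type*} [Fintype ι]

theorem finite_of_dualBasis (e : ι → M) (f : ι → M →ₗ[R] R) (h : ∀ m, ∑ i, f i m • e i = m) :
    Module.Finite R M :=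
  Module.Finite.of_surjective (Fintype.linearCombination R e)
    (fun m => ⟨fun i => f i m, by rw [Fintype.linearCombination_apply, h]⟩)

theorem projective_of_dualBasis (e : ι → M) (f : ι → M →ₗ[R] R)
    (h : ∀ m, ∑ i, f i m • e i = m) : Module.Projective R M :=
  Module.Projective.of_split (LinearMap.pi f) (Fintype.linearCombination R e)
    (LinearMap.ext fun m => by
      rw [LinearMap.comp_apply, Fintype.linearCombination_apply]; exact h m)

end DualBasis

/-! ### Balanced tensor products: contractions, right exactness, flatness -/

namespace BalTensor

variable {R : Type*} [Ring R]

section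

variable {M N : Type*} [AddCommGroup M] [Module Rᵐᵒᵖ M] [AddCommGroup N] [Module R N]

theorem exists_eq_sum (t : BalTensor R M N) :
    ∃ (ι : Type) (_ : Fintype ι) (m : ι → M) (n : ι → N), t = ∑ i, tmul R (m i) (n i) := by
  induction t using induction_on with
  | tm m n => exact ⟨Unit, inferInstance, fun _ => m, fun _ => n, by simp⟩
  | add s t hs ht =>
    obtain ⟨ι, _, m, n, rfl⟩ := hs
    obtain ⟨κ, _, m', n', rfl⟩ := ht
    exact ⟨ι ⊕ κ, inferInstance, Sum.elim m m', Sum.elim n n', by simp⟩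

theorem tmul_sum {ι : Type*} (s : Finset ι) (m : M) (n : ι → N) :
    tmul R m (∑ i ∈ s, n i) = ∑ i ∈ s, tmul R m (n i) :=
  map_sum (AddMonoidHom.mk' (fun n : N => tmul R m n) (tmul_add R m)) n s

theorem sum_tmul {ι : Type*} (s : Finset ι) (m : ι → M) (n : N) :
    tmul R (∑ i ∈ s, m i) n = ∑ i ∈ s, tmul R (m i) n :=
  map_sum (AddMonoidHom.mk' (fun m : M => tmul R m n) (fun m m' => add_tmul R m m' n)) m s

/-- On pure tensors the coefficients f_i(n) move across the tensor sign. A tensor is thus determined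
by its finitely many contractions. -/
theorem sum_rcontract_tmul {ι : Type*} [Fintype ι] (e : ι → N) (f : ι → N →ₗ[R] R)
    (h : ∀ n, ∑ i, f i n • e i = n) (t : BalTensor R M N) :
    ∑ i, tmul R (rcontract (f i) t) (e i) = t := by
  induction t using induction_on with
  | tm m n =>
    conv_rhs => rw [← h n, tmul_sum]
    exact Finset.sum_congr rfl fun i _ => by rw [rcontract_tmul, smul_tmul]
  | add s t hs ht =>
    conv_rhs => rw [← hs, ← ht]
    simp only [map_add, add_tmul, Finset.sum_add_distrib]

end

section

variable {M M' N : Type*} [AddCommGroup M] [Module Rᵐᵒᵖ M] [AddCommGroup M'] [Module Rᵐᵒᵖ M']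
  [AddCommGroup N] [Module R N]

theorem rcontract_map (f : M →ₗ[Rᵐᵒᵖ] M') (g : N →ₗ[R] R) (t : BalTensor R M N) :
    rcontract g (map f LinearMap.id t) = f (rcontract g t) := by
  induction t using induction_on with
  | tm m n => rw [map_tmul, rcontract_tmul, rcontract_tmul, map_smul]; rfl
  | add s t hs ht => rw [map_add, map_add, hs, ht, map_add, map_add]

theorem map_comp {M'' : Type*} [AddCommGroup M''] [Module Rᵐᵒᵖ M''] (g : M' →ₗ[Rᵐᵒᵖ] M'')
    (f : M →ₗ[Rᵐᵒᵖ] M') (t : BalTensor R M N) :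
    map (g.comp f) (LinearMap.id : N →ₗ[R] N) t = map g LinearMap.id (map f LinearMap.id t) := by
  induction t using induction_on with
  | tm m n => rfl
  | add s t hs ht => rw [map_add, map_add, map_add, hs, ht]

/-- Right exactness of `- ⊗_R N`. -/
theorem exists_map_subtype_eq (π : M →ₗ[Rᵐᵒᵖ] M') (hπ : Function.Surjective π)
    (t : BalTensor R M N) (ht : map π (LinearMap.id : N →ₗ[R] N) t = 0) :
    ∃ s, map (LinearMap.ker π).subtype (LinearMap.id : N →ₗ[R] N) s = t := by
  set T := (map (LinearMap.ker π).subtype (LinearMap.id : N →ₗ[R] N)).range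
  let q : BalTensor R M N →+ BalTensor R M N ⧸ T := QuotientAddGroup.mk' T
  -- Modulo T the class of m ⊗ n depends only on π m, since m - m' lies in the kernel.
  have key : ∀ (m m' : M) (n : N), π m = π m' → q (tmul R m n) = q (tmul R m' n) := by
    intro m m' n h
    rw [← sub_eq_zero, ← map_sub]
    refine (QuotientAddGroup.eq_zero_iff _).2 ⟨tmul R ⟨m - m', ?_⟩ n, ?_⟩
    · rw [LinearMap.mem_ker, map_sub, h, sub_self]
    · rw [map_tmul, eq_sub_iff_add_eq]
      exact (add_tmul R (m - m') m' n).symm.trans (by rw [sub_add_cancel])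
  -- A set-theoretic section is enough: by `key` its failure to be linear is invisible modulo T. The
  -- resulting ψ satisfies ψ ∘ (π ⊗ id) = q.
  obtain ⟨σ, hσ⟩ := hπ.hasRightInverse
  let ψ : BalTensor R M' N →+ BalTensor R M N ⧸ T := lift
    (AddMonoidHom.mk' (fun m' => AddMonoidHom.mk' (fun n => q (tmul R (σ m') n))
        (fun n n' => by rw [tmul_add, map_add]))
      (fun m m' => by
        ext n
        change q _ = q _ + q _
        rw [← map_add, ← add_tmul]
        exact key _ _ _ (by rw [map_add, hσ, hσ, hσ])))
    (fun m r n => by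
      change q _ = q _
      rw [← smul_tmul]
      exact key _ _ _ (by rw [map_smul, hσ, hσ]))
  have h : ψ.comp (map π LinearMap.id) = q :=
    hom_ext fun m n => key _ _ _ (hσ _)
  have h0 : q t = 0 := by rw [← h, AddMonoidHom.comp_apply, ht, map_zero]
  exact (QuotientAddGroup.eq_zero_iff t).1 h0

end

end BalTensor

open BalTensor

/-- Contractions commute with j ⊗ id, so the coefficients of t in the dual basis are killed by the
injective map j. -/
theorem isFlat_of_dualBasis {R N : Type u} [Ring R] [AddCommGroup N] [Module R N] {ι : Type*}
    [Fintype ι] (e : ι → N) (f : ι → N →ₗ[R] R) (h : ∀ n, ∑ i, f i n • e i = n) :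
    IsFlat R N := by
  intro M M' _ _ _ _ j hj
  rw [injective_iff_map_eq_zero]
  intro t ht
  rw [← sum_rcontract_tmul e f h t]
  refine Finset.sum_eq_zero fun i _ => ?_
  have h0 : rcontract (f i) t = 0 := hj (by rw [← rcontract_map, ht, map_zero, map_zero])
  rw [h0, zero_tmul]

/-- Factor f through M / ker f. Flatness cancels the injective factor, and right exactness handles
the projection. -/
theorem IsFlat.exists_map_subtype_eq {R N : Type u} [Ring R] [AddCommGroup N] [Module R N]
    (hN : IsFlat R N) {M M' : Type u} [AddCommGroup M] [Module Rᵐᵒᵖ M] [AddCommGroup M']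
    [Module Rᵐᵒᵖ M'] (f : M →ₗ[Rᵐᵒᵖ] M') (t : BalTensor R M N)
    (ht : BalTensor.map f (LinearMap.id : N →ₗ[R] N) t = 0) :
    ∃ s, BalTensor.map (LinearMap.ker f).subtype (LinearMap.id : N →ₗ[R] N) s = t := by
  have hinj : Function.Injective ((LinearMap.ker f).liftQ f le_rfl) :=
    LinearMap.ker_eq_bot.1 (Submodule.ker_liftQ_eq_bot _ _ _ le_rfl)
  have h0 : BalTensor.map (LinearMap.ker f).mkQ (LinearMap.id : N →ₗ[R] N) t = 0 := by
    apply hN _ _ _ hinj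
    rw [← BalTensor.map_comp, Submodule.liftQ_mkQ, ht, map_zero]
  obtain ⟨s, hs⟩ := BalTensor.exists_map_subtype_eq _ (Submodule.mkQ_surjective _) t h0
  -- The tensor s lives over the kernel of the projection, which equals ker f only propositionally.
  -- It is rewritten summand by summand.
  obtain ⟨ι, _, m, n, rfl⟩ := exists_eq_sum s
  refine ⟨∑ i, tmul R ⟨m i, by simpa using (m i).2⟩ (n i), ?_⟩
  rw [← hs, map_sum, map_sum]
  rfl

/-! ### Multiplication in the left dual ring -/

section GroupLike

variable {A C : Type u} [Ring A] [AddCommGroup C] [Module A C] [Module Aᵐᵒᵖ C]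
  [SMulCommClass A Aᵐᵒᵖ C] [Coring A C]

namespace LeftDual

theorem map_smul' (f : LeftDual A C) (a : A) (c : C) : f (a • c) = a * f c :=
  (toLin f).map_smul a c

theorem mulRight_apply (f : LeftDual A C) (a : A) (c : C) : mulRight f a c = f c * a := rfl

theorem contract_mulRight (f : LeftDual A C) (a : A) (c : C) :
    contract (mulRight f a) c = op a • contract f c := by
  rw [contract_apply, contract_apply]
  generalize (Coring.comul c : BalTensor A C C) = t
  induction t using BalTensor.induction_on with
  | tm m n => rw [rcontract_tmul, rcontract_tmul, ← mul_smul, ← op_mul]; rfl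
  | add s t hs ht => rw [map_add, map_add, smul_add, hs, ht]

theorem sum_apply {ι : Type*} (s : Finset ι) (f : ι → LeftDual A C) (c : C) :
    (∑ i ∈ s, f i) c = ∑ i ∈ s, f i c := by
  rw [map_sum]
  exact LinearMap.sum_apply ..

theorem counit_contract (f : LeftDual A C) (c : C) : Coring.counit (contract f c) = f c := by
  rw [← one_apply, ← mul_apply, mul_one]

/-- The elements `mulRight 1 a` form the image of A in `*C`. This lemma and the next describe
multiplication by them on either side. -/
theorem mul_mulRight_one (f : LeftDual A C) (a : A) : f * mulRight 1 a = mulRight f a :=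
  ext fun c => by
    rw [mul_apply, mulRight_apply, mulRight_apply, one_apply, counit_contract]

theorem mulRight_one_mul (f : LeftDual A C) (a : A) (c : C) :
    (mulRight 1 a * f : LeftDual A C) c = f (op a • c) := by
  rw [mul_apply, contract_mulRight, contract_one]

theorem sum_contract_tmul {ι : Type*} [Fintype ι] (e : ι → C) (f : ι → LeftDual A C)
    (h : ∀ c, ∑ i, f i c • e i = c) (c : C) :
    ∑ i, tmul A (contract (f i) c) (e i) = Coring.comul c :=
  sum_rcontract_tmul e (fun i => toLin (f i)) h (Coring.comul c)

/-- The dual basis makes `*C` separate the points of C, so equations in C may be tested in `*C`. -/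
theorem eq_of_forall_apply_eq {ι : Type*} [Fintype ι] (e : ι → C) (f : ι → LeftDual A C)
    (h : ∀ c, ∑ i, f i c • e i = c) {c d : C} (hcd : ∀ g : LeftDual A C, g c = g d) : c = d := by
  rw [← h c, ← h d]
  exact Finset.sum_congr rfl fun i _ => by rw [hcd]

end LeftDual

variable (x : GroupLikeElem A C)

/-! ### The Morita context -/

theorem contract_moritaQ (q : MoritaQ x) (c : C) :
    LeftDual.contract q.1 c = q.1 c • x.val := q.2 c

theorem moritaF_tmul (q : MoritaQ x) (a : RegMod x) :
    moritaF x (tmul _ q a) = LeftDual.mulRight q.1 (RegMod.val a) := rfl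

/-- The defining property of Q is used here: contracting c with q a gives q(c) x a, and g takes this
to q(c) g(x a). -/
theorem moritaF_tmul_mul (q : MoritaQ x) (a : RegMod x) (g : LeftDual A C) :
    moritaF x (tmul _ q a) * g = moritaF x (tmul _ q (op g • a)) :=
  LeftDual.ext fun c => by
    rw [moritaF_tmul, moritaF_tmul, LeftDual.mul_apply, LeftDual.contract_mulRight,
      contract_moritaQ, ← smul_comm (q.1 c), LeftDual.map_smul', LeftDual.mulRight_apply]
    rfl

theorem mul_moritaF_tmul (g : LeftDual A C) (q : MoritaQ x) (a : RegMod x) :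
    g * moritaF x (tmul _ q a) = moritaF x (tmul _ (g • q) a) := rfl

/-- Mixed associativity of the Morita context. This law and its mirror image below turn a
decomposition of 1 into dual bases of A and of Q. -/
theorem moritaF_tmul_smul (q : MoritaQ x) (a b : RegMod x) :
    op (moritaF x (tmul _ q a)) • b = moritaG x b q • a := rfl

theorem moritaF_tmul_mul_moritaQ (q q' : MoritaQ x) (a : RegMod x) :
    moritaF x (tmul _ q a) * q'.1 = (op (moritaG x a q') • q : MoritaQ x).1 := by
  rw [moritaF_tmul_mul]; rfl

/-- `q ∈ Q` if and only if `q g = q · g(x)` for all `g ∈ *C`. -/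
theorem mem_moritaQ_of_forall_mul {ι : Type*} [Fintype ι] (e : ι → C) (f : ι → LeftDual A C)
    (h : ∀ c, ∑ i, f i c • e i = c) {q : LeftDual A C}
    (hq : ∀ g : LeftDual A C, q * g = LeftDual.mulRight q (g x.val)) : q ∈ MoritaQ x :=
  fun c => LeftDual.eq_of_forall_apply_eq e f h fun g => by
    rw [← LeftDual.mul_apply, hq, LeftDual.map_smul']; rfl

/-- The image of F is a right ideal, so that F is surjective as soon as it reaches 1. -/
theorem moritaF_mul_mem_range (t : BalTensor (coinvRing x) (MoritaQ x) (RegMod x))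
    (g : LeftDual A C) : ∃ s, moritaF x s = moritaF x t * g := by
  induction t using BalTensor.induction_on with
  | tm q a => exact ⟨_, (moritaF_tmul_mul x q a g).symm⟩
  | add t t' h h' =>
    obtain ⟨s, hs⟩ := h
    obtain ⟨s', hs'⟩ := h'
    exact ⟨s + s', by rw [map_add, hs, hs', map_add, add_mul]⟩

theorem moritaF_surjective_of_one {t : BalTensor (coinvRing x) (MoritaQ x) (RegMod x)}
    (ht : moritaF x t = 1) : Function.Surjective (moritaF x) := fun g => by
  simpa [ht] using moritaF_mul_mem_range x t g

/-! ### Decompositions of the unit of the left dual ring -/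

section Unit

variable {ι : Type*} [Fintype ι] (q : ι → MoritaQ x) (a : ι → RegMod x)

theorem exists_unit_of_moritaF_surjective (h : Function.Surjective (moritaF x)) :
    ∃ (ι : Type) (_ : Fintype ι) (q : ι → MoritaQ x) (a : ι → RegMod x),
      ∑ j, moritaF x (tmul _ (q j) (a j)) = 1 := by
  obtain ⟨t, ht⟩ := h 1
  obtain ⟨ι, _, q, a, rfl⟩ := exists_eq_sum t
  exact ⟨ι, _, q, a, by rw [← ht, map_sum]⟩

theorem moritaF_surjective_of_unit (h : ∑ j, moritaF x (tmul _ (q j) (a j)) = 1) :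
    Function.Surjective (moritaF x) :=
  moritaF_surjective_of_one x (t := ∑ j, tmul _ (q j) (a j)) (by rw [map_sum, h])

variable {q a} (h : ∑ j, moritaF x (tmul _ (q j) (a j)) = 1)
include h

/-- Let 1 = ∑ q_j a_j act on b and use mixed associativity. -/
theorem sum_moritaG_smul (b : RegMod x) : ∑ j, moritaG x b (q j) • a j = b := by
  simp only [← moritaF_tmul_smul]
  rw [← Finset.sum_smul, ← Finset.op_sum, h, op_one, one_smul]

theorem sum_moritaG_smul_moritaQ (p : MoritaQ x) : ∑ j, op (moritaG x (a j) p) • q j = p := by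
  apply Subtype.ext
  rw [AddSubmonoidClass.coe_finsetSum]
  simp only [← moritaF_tmul_mul_moritaQ]
  rw [← Finset.sum_mul, h, one_mul]

end Unit

/-- A right linear form on a right module, with values in `Rᵐᵒᵖ`. -/
def opForm {R M : Type*} [Ring R] [AddCommGroup M] [Module Rᵐᵒᵖ M] (φ : M →ₗ[Rᵐᵒᵖ] R) :
    M →ₗ[Rᵐᵒᵖ] Rᵐᵒᵖ where
  toFun m := op (φ m)
  map_add' m n := by rw [map_add, op_add]
  map_smul' r m := by rw [map_smul]; rfl

/-- A right linear form on a right module, with values in `R`. -/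
def unopForm {R M : Type*} [Ring R] [AddCommGroup M] [Module Rᵐᵒᵖ M] (φ : M →ₗ[Rᵐᵒᵖ] Rᵐᵒᵖ) :
    M →ₗ[Rᵐᵒᵖ] R where
  toFun m := unop (φ m)
  map_add' m n := by rw [map_add, unop_add]
  map_smul' r m := by rw [map_smul]; rfl

/-- `a ↦ a ↼ q` as a left `B`-linear form on `A`. -/
def moritaForm (q : MoritaQ x) : RegMod x →ₗ[coinvRing x] coinvRing x where
  toFun b := moritaG x b q
  map_add' b c := Subtype.ext (congrArg RegMod.val (smul_add (op q.1) b c))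
  map_smul' b c := Subtype.ext (congrArg RegMod.val (smul_comm b (op q.1) c).symm)

theorem Omega_smul (b : coinvRing x) (a : RegMod x) (q : MoritaQ x) :
    Omega x (b • a) q = b * Omega x a q :=
  Subtype.ext (congrArg RegMod.val (smul_comm b (op q.1) a).symm)

/-! ### Consequences of the surjectivity of `F` -/

section Unit

variable {ι : Type*} [Fintype ι] {q : ι → MoritaQ x} {a : ι → RegMod x}
  (h : ∑ j, moritaF x (tmul _ (q j) (a j)) = 1)
include h

/-- F(t) determines t through t = ∑ F(t) q_j ⊗ a_j. For t = p ⊗ b, expand b = ∑ (b ↼ q_j) a_j and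
move the coefficients, which lie in B, to p. -/
theorem moritaF_injective_of_unit : Function.Injective (moritaF x) := by
  rw [injective_iff_map_eq_zero]
  intro t ht
  have key : ∀ s, ∑ j, tmul (coinvRing x)
      (⟨moritaF x s * (q j).1, (MoritaQ x).smul_mem _ (q j).2⟩ : MoritaQ x) (a j) = s := by
    intro s
    induction s using BalTensor.induction_on with
    | tm p b =>
      conv_rhs => rw [← sum_moritaG_smul x h b, tmul_sum]
      refine Finset.sum_congr rfl fun j _ => ?_
      rw [← smul_tmul]
      congr 1
      exact Subtype.ext (moritaF_tmul_mul_moritaQ x p (q j) b)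
    | add s s' hs hs' =>
      conv_rhs => rw [← hs, ← hs', ← Finset.sum_add_distrib]
      refine Finset.sum_congr rfl fun j _ => ?_
      rw [← add_tmul]
      congr 1
      exact Subtype.ext ((congrArg (· * (q j).1) (map_add _ s s')).trans (add_mul _ _ _))
  rw [← key t]
  refine Finset.sum_eq_zero fun j _ => ?_
  have h0 : (⟨moritaF x t * (q j).1, (MoritaQ x).smul_mem _ (q j).2⟩ : MoritaQ x) = 0 :=
    Subtype.ext ((congrArg (· * (q j).1) ht).trans (zero_mul _))
  rw [h0, zero_tmul]

theorem finite_regMod_of_unit : Module.Finite (coinvRing x) (RegMod x) :=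
  finite_of_dualBasis a (fun j => moritaForm x (q j)) (sum_moritaG_smul x h)

theorem projective_regMod_of_unit : Module.Projective (coinvRing x) (RegMod x) :=
  projective_of_dualBasis a (fun j => moritaForm x (q j)) (sum_moritaG_smul x h)

theorem isFlat_regMod_of_unit : IsFlat (coinvRing x) (RegMod x) :=
  isFlat_of_dualBasis a (fun j => moritaForm x (q j)) (sum_moritaG_smul x h)

/-- Multiplying 1 on the left by f gives f = ∑ (f q_j) a_j. -/
theorem eq_of_forall_mul_moritaQ_eq {f g : LeftDual A C} (hfg : ∀ p : MoritaQ x, f • p = g • p) :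
    f = g := by
  rw [← mul_one f, ← mul_one g, ← h, Finset.mul_sum, Finset.mul_sum]
  refine Finset.sum_congr rfl fun j _ => ?_
  rw [mul_moritaF_tmul, mul_moritaF_tmul, hfg]

theorem faithful_moritaQ_of_unit : FaithfulSMul (LeftDual A C) (MoritaQ x) :=
  ⟨fun hfg => eq_of_forall_mul_moritaQ_eq x h hfg⟩

/-- Injectivity: f = ∑ q_j (a_j ↼ f) depends only on the action of f on A. Surjectivity: the element
∑ q_j φ(a_j) sends b to ∑ (b ↼ q_j) φ(a_j), which is φ(b) by B-linearity. -/
theorem bijective_Lambda_of_unit : Function.Bijective (Lambda x) := by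
  constructor
  · intro f g hfg
    have hfg' : ∀ b : RegMod x, op f • b = op g • b := fun b =>
      LinearMap.congr_fun (congrArg unop hfg) b
    rw [← one_mul f, ← one_mul g, ← h, Finset.sum_mul, Finset.sum_mul]
    refine Finset.sum_congr rfl fun j _ => ?_
    rw [moritaF_tmul_mul, moritaF_tmul_mul, hfg']
  · intro φ
    refine ⟨∑ j, moritaF x (tmul _ (q j) (φ.unop (a j))), ?_⟩
    apply unop_injective
    ext b
    change op (∑ j, moritaF x (tmul _ (q j) (φ.unop (a j)))) • b = φ.unop b
    conv_rhs => rw [← sum_moritaG_smul x h b, map_sum]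
    rw [Finset.op_sum, Finset.sum_smul]
    exact Finset.sum_congr rfl fun j _ => by rw [moritaF_tmul_smul, map_smul]

theorem finite_moritaQ_of_unit : Module.Finite (coinvRing x)ᵐᵒᵖ (MoritaQ x) :=
  finite_of_dualBasis q (fun j => opForm (Omega x (a j))) (sum_moritaG_smul_moritaQ x h)

theorem projective_moritaQ_of_unit : Module.Projective (coinvRing x)ᵐᵒᵖ (MoritaQ x) :=
  projective_of_dualBasis q (fun j => opForm (Omega x (a j))) (sum_moritaG_smul_moritaQ x h)

/-- Dual to the argument for Λ: b is recovered as ∑ Ω(b)(q_j) a_j, and ∑ φ(q_j) a_j is a preimage of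
φ. -/
theorem bijective_Omega_of_unit : Function.Bijective (Omega x) := by
  constructor
  · intro b c hbc
    rw [← sum_moritaG_smul x h b, ← sum_moritaG_smul x h c]
    exact Finset.sum_congr rfl fun j _ => congrArg (· • a j) (LinearMap.congr_fun hbc (q j))
  · intro φ
    refine ⟨∑ j, φ (q j) • a j, ?_⟩
    ext1 p
    conv_rhs => rw [← sum_moritaG_smul_moritaQ x h p, map_sum]
    rw [map_sum, LinearMap.sum_apply]
    refine Finset.sum_congr rfl fun j _ => ?_
    rw [Omega_smul, map_smul]
    rfl

end Unit

theorem isBimoduleIsoOmega_of_bijective (h : Function.Bijective (Omega x)) :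
    IsBimoduleIsoOmega x :=
  ⟨h, Omega_smul x,
    fun g a q => Subtype.ext (congrArg RegMod.val (mul_smul (op q.1) (op g) a).symm)⟩

/-- The functionals of a dual basis q_j of Q have the form Ω(a_j). Hence ∑ q_j a_j acts on Q as the
identity and equals 1 by faithfulness. -/
theorem moritaF_surjective_of_bijective_Omega [Module.Finite (coinvRing x)ᵐᵒᵖ (MoritaQ x)]
    [Module.Projective (coinvRing x)ᵐᵒᵖ (MoritaQ x)] [FaithfulSMul (LeftDual A C) (MoritaQ x)]
    (hΩ : Function.Bijective (Omega x)) : Function.Surjective (moritaF x) := by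
  obtain ⟨n, q, φ, hφ⟩ := exists_dualBasis (coinvRing x)ᵐᵒᵖ (MoritaQ x)
  choose a ha using fun j => hΩ.2 (unopForm (φ j))
  refine moritaF_surjective_of_unit x q a (FaithfulSMul.eq_of_smul_eq_smul (α := MoritaQ x)
    fun p => Subtype.ext ?_)
  change (∑ j, moritaF x (tmul _ (q j) (a j))) * p.1 = 1 * p.1
  rw [one_mul, Finset.sum_mul]
  conv_rhs => rw [← hφ p, AddSubmonoidClass.coe_finsetSum]
  refine Finset.sum_congr rfl fun j _ => ?_
  rw [moritaF_tmul_mul_moritaQ]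
  congr 2
  change op (Omega x (a j) p) = _
  rw [ha]
  rfl

section DualBasis

variable {κ : Type*} [Fintype κ] (e : κ → C) (f : κ → LeftDual A C)
  (hef : ∀ c, ∑ i, f i c • e i = c)
include hef

/-- For a dual basis (a_j, φ_j) of A, surjectivity of Λ realises each φ_j as the action of some q_j
∈ Q. Then ∑ q_j a_j acts on A as the identity, and Λ is injective. -/
theorem moritaF_surjective_of_bijective_Lambda [Module.Finite (coinvRing x) (RegMod x)]
    [Module.Projective (coinvRing x) (RegMod x)] (hΛ : Function.Bijective (Lambda x)) :
    Function.Surjective (moritaF x) := by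
  obtain ⟨n, a, φ, hφ⟩ := exists_dualBasis (coinvRing x) (RegMod x)
  have hinj : ∀ f g : LeftDual A C, (∀ b : RegMod x, op f • b = op g • b) → f = g :=
    fun f g hfg => hΛ.1 (unop_injective (LinearMap.ext hfg))
  -- The functional φ_j has values in B; composed with the inclusion B ⊆ A it is an endomorphism of
  -- A.
  choose q hq using fun j => hΛ.2 (op
    { toFun := fun b => φ j b • (RegMod.val.symm 1 : RegMod x)
      map_add' := fun b c => by rw [map_add, add_smul]
      map_smul' := fun b c => by rw [map_smul, smul_eq_mul, mul_smul]; rfl })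
  have hq' : ∀ j (b : RegMod x), op (q j) • b = φ j b • (RegMod.val.symm 1 : RegMod x) :=
    fun j b => LinearMap.congr_fun (congrArg unop (hq j)) b
  have one_smul_dual : ∀ g : LeftDual A C,
      op g • (RegMod.val.symm 1 : RegMod x) = RegMod.val.symm (g x.val) := fun g => by
    change RegMod.val.symm (g (op (1 : A) • x.val)) = _
    rw [op_one, one_smul]
  -- Both q_j g and q_j · g(x) send b to φ_j(b) g(x), so injectivity of Λ identifies them.
  have hmem : ∀ j, q j ∈ MoritaQ x := fun j =>
    mem_moritaQ_of_forall_mul x e f hef fun g => hinj _ _ fun b => by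
      have h1 : op (LeftDual.mulRight (q j) (g x.val)) • b =
          op (g x.val) • op (q j) • b := rfl
      rw [h1, op_mul, mul_smul, hq', ← smul_comm (φ j b), ← smul_comm (φ j b), one_smul_dual]
      congr 1
      exact (one_mul (g x.val)).symm
  refine moritaF_surjective_of_unit x (fun j => ⟨q j, hmem j⟩) a (hinj _ _ fun b => ?_)
  rw [op_one, one_smul, Finset.op_sum, Finset.sum_smul]
  conv_rhs => rw [← hφ b]
  refine Finset.sum_congr rfl fun j _ => ?_
  rw [moritaF_tmul_smul]
  congr 1
  refine Subtype.ext ((congrArg RegMod.val (hq' j b)).trans ?_)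
  exact mul_one _

end DualBasis

/-! ### Generators -/

/-- `a ↦ m (q a)` as a right `*C`-linear map. -/
def moritaHom (q : MoritaQ x) (M : Type*) [AddCommGroup M] [Module (LeftDual A C)ᵐᵒᵖ M] (m : M) :
    RegMod x →ₗ[(LeftDual A C)ᵐᵒᵖ] M where
  toFun a := op (moritaF x (tmul _ q a)) • m
  map_add' a b := by rw [tmul_add, map_add, op_add, add_smul]
  map_smul' g a := by
    obtain ⟨g, rfl⟩ := op_surjective g
    rw [← moritaF_tmul_mul, op_mul, mul_smul]
    rfl

/-- `M` is generated by `P` if every element is a sum of values of linear maps `P → M`. -/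
theorem isGenerated_of_forall_exists_sum {S P M : Type u} [Ring S] [AddCommGroup P] [Module S P]
    [AddCommGroup M] [Module S M] (h : ∀ m : M, ∃ (ι : Type) (_ : Fintype ι)
      (f : ι → P →ₗ[S] M) (p : ι → P), m = ∑ i, f i (p i)) : IsGenerated S P M := by
  refine ⟨P →ₗ[S] M, Finsupp.lsum ℕ fun f => f, fun m => ?_⟩
  obtain ⟨ι, _, f, p, rfl⟩ := h m
  exact ⟨∑ i, Finsupp.single (f i) (p i), by simp⟩

theorem IsGenerated.exists_sum {S P M : Type u} [Ring S] [AddCommGroup P] [Module S P]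
    [AddCommGroup M] [Module S M] (h : IsGenerated S P M) (m : M) :
    ∃ (ι : Type u) (_ : Fintype ι) (f : ι → P →ₗ[S] M) (p : ι → P), m = ∑ i, f i (p i) := by
  obtain ⟨I, F, hF⟩ := h
  obtain ⟨a, rfl⟩ := hF m
  refine ⟨a.support, inferInstance, fun i => F.comp (Finsupp.lsingle i.1), fun i => a i.1, ?_⟩
  conv_lhs => rw [← Finsupp.sum_single a, Finsupp.sum, map_sum]
  exact (Finset.sum_coe_sort a.support (fun i => F (Finsupp.single i (a i)))).symm

/-- Each m equals ∑ m (q_j a_j), a sum of values of the maps a ↦ m (q_j a). -/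
theorem isGenerator_of_moritaF_surjective (h : Function.Surjective (moritaF x)) :
    IsGenerator (LeftDual A C)ᵐᵒᵖ (RegMod x) := by
  obtain ⟨ι, _, q, a, h⟩ := exists_unit_of_moritaF_surjective x h
  refine fun M _ _ => isGenerated_of_forall_exists_sum fun m =>
    ⟨ι, ‹_›, fun j => moritaHom x (q j) M m, a, ?_⟩
  conv_lhs => rw [← one_smul (LeftDual A C)ᵐᵒᵖ m, ← op_one, ← h, Finset.op_sum, Finset.sum_smul]
  rfl

/-- A linear map ψ : A → `*C` is b ↦ q b with q = ψ(1), because b = 1 ↼ (ε b). Moreover q g = ψ(1 ↼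
g) = ψ(g(x)) = q g(x), which puts q in Q. It remains to write 1 ∈ `*C` as a sum of values of such
maps. -/
theorem moritaF_surjective_of_isGenerator {κ : Type*} [Fintype κ] (e : κ → C)
    (f : κ → LeftDual A C) (hef : ∀ c, ∑ i, f i c • e i = c)
    (h : IsGenerator (LeftDual A C)ᵐᵒᵖ (RegMod x)) : Function.Surjective (moritaF x) := by
  obtain ⟨ι, _, φ, a, hφ⟩ := (h (LeftDual A C)).exists_sum (1 : LeftDual A C)
  have key : ∀ (ψ : RegMod x →ₗ[(LeftDual A C)ᵐᵒᵖ] LeftDual A C) (b : RegMod x),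
      ψ b = LeftDual.mulRight (ψ (RegMod.val.symm 1)) (RegMod.val b) := fun ψ b => by
    have hb : b = op (LeftDual.mulRight (1 : LeftDual A C) (RegMod.val b)) • (RegMod.val.symm 1 : RegMod x) := by
      change RegMod.val b = Coring.counit (op (1 : A) • x.val) * RegMod.val b
      rw [op_one, one_smul, x.counit_val, one_mul]
    conv_lhs => rw [hb, map_smul]
    exact LeftDual.mul_mulRight_one _ _
  refine moritaF_surjective_of_unit x (fun i => ⟨φ i (RegMod.val.symm 1),
    mem_moritaQ_of_forall_mul x e f hef fun g => ?_⟩) a ?_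
  · have h1 : op g • (RegMod.val.symm 1 : RegMod x) = RegMod.val.symm (g x.val) := by
      change g (op (1 : A) • x.val) = g x.val
      rw [op_one, one_smul]
    change op g • φ i (RegMod.val.symm 1) = _
    rw [← map_smul, h1, key]
    rfl
  · rw [hφ]
    exact Finset.sum_congr rfl fun i _ => (key _ _).symm

open CategoryTheory

theorem faithful_homFunctor_of_isGenerator (h : IsGenerator (LeftDual A C)ᵐᵒᵖ (RegMod x)) :
    (homFunctor x).Faithful := by
  refine ⟨fun {M N} φ ψ hφψ => ModuleCat.hom_ext (LinearMap.ext fun m => ?_)⟩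
  obtain ⟨ι, _, f, p, rfl⟩ := (h M).exists_sum m
  rw [map_sum, map_sum]
  refine Finset.sum_congr rfl fun i _ => ?_
  have h1 := LinearMap.congr_fun (congrArg ModuleCat.Hom.hom hφψ) (DualHom.lin.symm (f i))
  exact LinearMap.congr_fun (congrArg DualHom.lin h1) (p i)

/-- Every map A → M lands in the trace of A in M, so the functor sends the projection of M modulo
the trace to zero. By faithfulness the projection itself vanishes. -/
theorem isGenerator_of_faithful_homFunctor (h : (homFunctor x).Faithful) :
    IsGenerator (LeftDual A C)ᵐᵒᵖ (RegMod x) := by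
  intro M _ _
  let F : ((RegMod x →ₗ[(LeftDual A C)ᵐᵒᵖ] M) →₀ RegMod x) →ₗ[(LeftDual A C)ᵐᵒᵖ] M :=
    Finsupp.lsum ℕ fun f => f
  refine ⟨_, F, LinearMap.range_eq_top.1 ?_⟩
  rw [← Submodule.ker_mkQ (LinearMap.range F), LinearMap.ker_eq_top]
  have h1 : ModuleCat.ofHom (LinearMap.range F).mkQ =
      ModuleCat.ofHom (0 : M →ₗ[(LeftDual A C)ᵐᵒᵖ] M ⧸ LinearMap.range F) := by
    apply h.map_injective
    refine ModuleCat.hom_ext (LinearMap.ext fun f => ?_)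
    apply DualHom.lin.injective
    refine LinearMap.ext fun a => ?_
    change (LinearMap.range F).mkQ (DualHom.lin f a) = 0
    rw [Submodule.mkQ_apply, Submodule.Quotient.mk_eq_zero]
    exact ⟨Finsupp.single (DualHom.lin f) a, by simp [F]⟩
  exact congrArg ModuleCat.Hom.hom h1

end GroupLike

/-! ### Tensoring isomorphisms and finite powers -/

theorem BalTensor.map_bijective_of_linearEquiv {R M M' N : Type*} [Ring R] [AddCommGroup M]
    [Module Rᵐᵒᵖ M] [AddCommGroup M'] [Module Rᵐᵒᵖ M'] [AddCommGroup N] [Module R N]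
    (e : M ≃ₗ[Rᵐᵒᵖ] M') :
    Function.Bijective (map (e : M →ₗ[Rᵐᵒᵖ] M') (LinearMap.id : N →ₗ[R] N)) := by
  have h1 : ∀ t, map (e.symm : M' →ₗ[Rᵐᵒᵖ] M) (LinearMap.id : N →ₗ[R] N)
      (map (e : M →ₗ[Rᵐᵒᵖ] M') LinearMap.id t) = t := fun t => by
    induction t using BalTensor.induction_on with
    | tm m n => simp
    | add s t hs ht => rw [map_add, map_add, hs, ht]
  have h2 : ∀ t, map (e : M →ₗ[Rᵐᵒᵖ] M') (LinearMap.id : N →ₗ[R] N)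
      (map (e.symm : M' →ₗ[Rᵐᵒᵖ] M) LinearMap.id t) = t := fun t => by
    induction t using BalTensor.induction_on with
    | tm m n => simp
    | add s t hs ht => rw [map_add, map_add, hs, ht]
  exact ⟨Function.LeftInverse.injective h1, Function.RightInverse.surjective h2⟩

/-- An element of `(ι → M) ⊗_R N` vanishes if its components do. -/
theorem BalTensor.eq_zero_of_forall_map_proj {R ι M N : Type*} [Ring R] [Fintype ι]
    [AddCommGroup M] [Module Rᵐᵒᵖ M] [AddCommGroup N] [Module R N] (t : BalTensor R (ι → M) N)
    (h : ∀ i, map (LinearMap.proj i : (ι → M) →ₗ[Rᵐᵒᵖ] M) (LinearMap.id : N →ₗ[R] N) t = 0) :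
    t = 0 := by
  classical
  have key : ∀ s : BalTensor R (ι → M) N, ∑ i, map (LinearMap.single Rᵐᵒᵖ (fun _ => M) i)
      (LinearMap.id : N →ₗ[R] N) (map (LinearMap.proj i : (ι → M) →ₗ[Rᵐᵒᵖ] M) LinearMap.id s)
      = s := fun s => by
    induction s using BalTensor.induction_on with
    | tm m n =>
      simp only [map_tmul]
      rw [LinearMap.id_apply, ← sum_tmul]
      congr 1
      exact Finset.univ_sum_single m
    | add s t hs ht =>
      conv_rhs => rw [← hs, ← ht]
      simp only [map_add, Finset.sum_add_distrib]
  rw [← key t]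
  exact Finset.sum_eq_zero fun i _ => by rw [h, map_zero]

/-! ### Coinvariants and the weak structure theorem -/

section GroupLike

variable {A C : Type u} [Ring A] [AddCommGroup C] [Module A C] [Module Aᵐᵒᵖ C]
  [SMulCommClass A Aᵐᵒᵖ C] [Coring A C] (x : GroupLikeElem A C)

section Comodule

variable (M : Type u) [AddCommGroup M] [Module Aᵐᵒᵖ M] [RightComodule A C M]

/-- `m q = ∑ m₀ q(m₁)` is coinvariant for `q ∈ Q`. -/
theorem rcontract_coact_mem_coinv (q : MoritaQ x) (m : M) :
    rcontract (LeftDual.toLin q.1) (RightComodule.coact (A := A) (C := C) m) ∈ Coinv x M := by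
  change RightComodule.coact (A := A) (C := C) _ = _
  -- Since ρ is A-linear, ρ(m₀ q(m₁)) is obtained from (ρ ⊗ id) ρ(m) by contracting the last factor
  -- with q; coassociativity then replaces this by m₀ ⊗ m₁ q(m₂).
  have h1 : ∀ t : BalTensor A M C, RightComodule.coact (A := A) (C := C)
      (rcontract (LeftDual.toLin q.1) t) =
      map (R := A) LinearMap.id (rcontractₗ (LeftDual.toLin q.1) : BalTensor A C C →ₗ[A] C)
        (assoc (map (R := A) (RightComodule.coact (A := A) (C := C)) LinearMap.id t)) := by
    intro t
    induction t using BalTensor.induction_on with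
    | tm m c =>
      rw [rcontract_tmul, map_smul, map_tmul, assoc_tmul]
      generalize RightComodule.coact (A := A) (C := C) m = s
      induction s using BalTensor.induction_on with
      | tm m' c' => rfl
      | add s s' h h' => rw [smul_add, h, h', map_add, map_add]
    | add s t hs ht => simp only [map_add, hs, ht]
  -- Here q ∈ Q turns m₁ q(m₂) into q(m₁) x.
  have h2 : ∀ t : BalTensor A M C,
      map (R := A) LinearMap.id (rcontractₗ (LeftDual.toLin q.1) : BalTensor A C C →ₗ[A] C)
        (map (R := A) LinearMap.id (Coring.comulₗ A C) t) =
      tmul A (rcontract (LeftDual.toLin q.1) t) x.val := by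
    intro t
    induction t using BalTensor.induction_on with
    | tm m c =>
      rw [rcontract_tmul, smul_tmul, ← contract_moritaQ]
      rfl
    | add s t hs ht => rw [map_add, map_add, map_add, add_tmul, hs, ht]
  rw [h1, RightComodule.coassoc, h2]

/-- The inverse is m ↦ ∑ m₀ q_j(m₁) ⊗ a_j. On one side, (m b) q = m (b ↼ q) for m coinvariant, and
this coefficient crosses the tensor sign. On the other, ∑ q_j(c) a_j = ε(c), so the counit law of M
applies. -/
theorem bijective_Psi_of_unit {ι : Type*} [Fintype ι] {q : ι → MoritaQ x} {a : ι → RegMod x}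
    (h : ∑ j, moritaF x (tmul _ (q j) (a j)) = 1) : Function.Bijective (Psi x M) := by
  let κ : MoritaQ x → M →+ Coinv x M := fun p => AddMonoidHom.mk'
    (fun m => ⟨_, rcontract_coact_mem_coinv x M p m⟩)
    (fun m n => Subtype.ext (by
      change rcontract _ _ = rcontract _ _ + rcontract _ _
      rw [map_add, map_add]))
  have h1 : ∀ t, ∑ j, tmul (coinvRing x) (κ (q j) (Psi x M t)) (a j) = t := fun t => by
    induction t using BalTensor.induction_on with
    | tm m b =>
      conv_rhs => rw [← sum_moritaG_smul x h b, tmul_sum]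
      refine Finset.sum_congr rfl fun j _ => ?_
      rw [← smul_tmul]
      congr 1
      apply Subtype.ext
      change rcontract _ (RightComodule.coact (A := A) (C := C)
        (op (RegMod.val b) • (m : M))) = _
      have hm : RightComodule.coact (A := A) (C := C) (m : M) = tmul A (m : M) x.val := m.2
      rw [map_smul, hm]
      rfl
    | add s t hs ht =>
      conv_rhs => rw [← hs, ← ht]
      simp only [map_add, add_tmul, Finset.sum_add_distrib]
  have h2 : ∀ m, Psi x M (∑ j, tmul (coinvRing x) (κ (q j) m) (a j)) = m := fun m => by
    have h3 : ∀ t : BalTensor A M C, ∑ j, op (RegMod.val (a j)) •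
        rcontract (LeftDual.toLin (q j).1) t = rcontract (Coring.counitₗ A C) t := fun t => by
      induction t using BalTensor.induction_on with
      | tm m c =>
        have h4 : Coring.counitₗ A C c = ∑ j, (q j).1 c * RegMod.val (a j) := by
          change (1 : LeftDual A C) c = _
          rw [← h, LeftDual.sum_apply]
          rfl
        rw [rcontract_tmul, h4, Finset.op_sum, Finset.sum_smul]
        refine Finset.sum_congr rfl fun j _ => ?_
        rw [rcontract_tmul, op_mul, mul_smul]
      | add s t hs ht =>
        rw [map_add, ← hs, ← ht, ← Finset.sum_add_distrib]
        simp only [map_add, smul_add]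
    rw [map_sum]
    exact (h3 _).trans (RightComodule.counit m)
  exact ⟨fun s t hst => by rw [← h1 s, hst, h1], fun m => ⟨_, h2 m⟩⟩

/-- `Hom^C(A, M) ≃ M^{co C}`, `f ↦ f(1)`. -/
def colinearHomEquivCoinv : ColinearHom A C (RegMod x) M ≃ₗ[(coinvRing x)ᵐᵒᵖ] Coinv x M where
  toFun f := ⟨f.1 (RegMod.val.symm 1), by
    have hf : RightComodule.coact (A := A) (C := C) (f.1 (RegMod.val.symm 1)) =
        tmul A (f.1 (RegMod.val.symm 1)) (op (1 : A) • x.val) := f.2 (RegMod.val.symm 1)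
    rw [op_one, one_smul] at hf
    exact hf⟩
  map_add' f g := rfl
  map_smul' b f := Subtype.ext (by
    change f.1 (b.unop • RegMod.val.symm 1) = op (b.unop : A) • f.1 (RegMod.val.symm 1)
    rw [← f.1.map_smul]
    congr 1
    change (b.unop : A) * 1 = 1 * (b.unop : A)
    rw [one_mul, mul_one])
  invFun m := ⟨
    { toFun := fun a => op (RegMod.val a) • (m : M)
      map_add' := fun a b => by rw [map_add, op_add, add_smul]
      map_smul' := fun r a => by
        obtain ⟨r, rfl⟩ := op_surjective r
        rw [RegMod.op_smul_def, op_mul, mul_smul]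
        rfl }, fun a => by
      have hm : RightComodule.coact (A := A) (C := C) (m : M) = tmul A (m : M) x.val := m.2
      change RightComodule.coact (A := A) (C := C) (op (RegMod.val a) • (m : M)) =
        tmul A (op (1 : A) • (m : M)) (op (RegMod.val a) • x.val)
      rw [map_smul, hm, op_one, one_smul]
      rfl⟩
  left_inv f := Subtype.ext (LinearMap.ext fun a => by
    change op (RegMod.val a) • f.1 (RegMod.val.symm 1) = f.1 a
    rw [← f.1.map_smul]
    congr 1
    exact one_mul (RegMod.val a))
  right_inv m := Subtype.ext (by
    change op (1 : A) • (m : M) = m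
    rw [op_one, one_smul])

/-- Since f(a) = f(1) a, the map Ψ' is Ψ preceded by an isomorphism tensored with A. -/
theorem bijective_Psi'_iff : Function.Bijective (Psi' x M) ↔ Function.Bijective (Psi x M) := by
  have h : Psi' x M = (Psi x M).comp (map (R := coinvRing x)
      (colinearHomEquivCoinv x M : ColinearHom A C (RegMod x) M →ₗ[(coinvRing x)ᵐᵒᵖ] Coinv x M)
      (LinearMap.id : RegMod x →ₗ[coinvRing x] RegMod x)) := by
    refine hom_ext fun f a => ?_
    change f.1 a = op (RegMod.val a) • f.1 (RegMod.val.symm 1)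
    rw [← f.1.map_smul]
    congr 1
    exact (one_mul (RegMod.val a)).symm
  rw [h, AddMonoidHom.coe_comp]
  exact (map_bijective_of_linearEquiv (colinearHomEquivCoinv x M)).of_comp_iff _

end Comodule

/-- `A ≃ C^{co C}`, `a ↦ a x`. -/
def regModEquivCoinv : RegMod x ≃ₗ[(coinvRing x)ᵐᵒᵖ] Coinv x C where
  toFun a := ⟨RegMod.val a • x.val, by
    change Coring.comul _ = _
    rw [Coring.comul_smul, x.comul_val]
    rfl⟩
  map_add' a b := Subtype.ext (by
    change RegMod.val (a + b) • x.val = RegMod.val a • x.val + RegMod.val b • x.val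
    rw [map_add, add_smul])
  map_smul' b a := Subtype.ext (by
    change (RegMod.val a * (b.unop : A)) • x.val = op (b.unop : A) • RegMod.val a • x.val
    rw [mul_smul, coinvRing_smul, smul_comm])
  invFun c := RegMod.val.symm (Coring.counit (c : C))
  left_inv a := by
    change Coring.counit (RegMod.val a • x.val) = RegMod.val a
    rw [Coring.counit_smul, x.counit_val, mul_one]
  right_inv c := Subtype.ext (by
    -- Applying ε ⊗ id to Δ(c) = c ⊗ x gives c = ε(c) x.
    have hc : Coring.comul (c : C) = tmul A (c : C) x.val := c.2
    change Coring.counit (c : C) • x.val = (c : C)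
    conv_rhs => rw [← Coring.counit_comul (A := A) (c : C), hc]
    rfl)

/-- Under the identification of A with the coinvariants of C, the map β becomes Ψ for C. -/
theorem bijective_Psi_self_iff : Function.Bijective (Psi x C) ↔ IsGaloisExt x := by
  have h : galoisMap x = (Psi x C).comp (map (R := coinvRing x)
      (regModEquivCoinv x : RegMod x →ₗ[(coinvRing x)ᵐᵒᵖ] Coinv x C)
      (LinearMap.id : RegMod x →ₗ[coinvRing x] RegMod x)) :=
    hom_ext fun a b => smul_comm (RegMod.val a) (op (RegMod.val b)) x.val
  rw [IsGaloisExt, h, AddMonoidHom.coe_comp]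
  exact ((map_bijective_of_linearEquiv (regModEquivCoinv x)).of_comp_iff _).symm

/-! ### Galois extensions with `A` flat over `B` -/

namespace GaloisDescent

/-- `C` as a right `B`-module. -/
instance instModuleCoring : Module (coinvRing x)ᵐᵒᵖ C :=
  Module.compHom C (RingHom.op (coinvRing x).subtype)

/-- `*C` as a right `B`-module. -/
instance instModuleLeftDual : Module (coinvRing x)ᵐᵒᵖ (LeftDual A C) where
  smul b q := LeftDual.mulRight q (b.unop : A)
  one_smul q := LeftDual.ext fun c => mul_one (q c)
  mul_smul b b' q := LeftDual.ext fun c => (mul_assoc (q c) (b'.unop : A) (b.unop : A)).symm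
  smul_zero b := LeftDual.ext fun c => zero_mul (b.unop : A)
  smul_add b p q := LeftDual.ext fun c => add_mul (p c) (q c) (b.unop : A)
  add_smul b b' q := LeftDual.ext fun c => mul_add (q c) (b.unop : A) b'.unop
  zero_smul q := LeftDual.ext fun c => mul_zero (q c)

/-- `u ↦ r u` on `A`. -/
def leftMul (r : A) : RegMod x →ₗ[(coinvRing x)ᵐᵒᵖ] RegMod x where
  toFun u := RegMod.val.symm (r * RegMod.val u)
  map_add' u v := mul_add r (RegMod.val u) (RegMod.val v)
  map_smul' b u := (mul_assoc r (RegMod.val u) (b.unop : A)).symm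

/-- `c ↦ r c` on `C`. -/
def leftSMul (r : A) : C →ₗ[(coinvRing x)ᵐᵒᵖ] C where
  toFun c := r • c
  map_add' := smul_add r
  map_smul' b c := smul_comm r (op (b.unop : A)) c

/-- `u ↦ c u`. -/
def orbit (c : C) : RegMod x →ₗ[(coinvRing x)ᵐᵒᵖ] C where
  toFun u := op (RegMod.val u) • c
  map_add' u v := by rw [map_add, op_add, add_smul]
  map_smul' b u := mul_smul (op (b.unop : A)) (op (RegMod.val u)) c

/-- `u ↦ u x`. -/
def leftOrbit : RegMod x →ₗ[(coinvRing x)ᵐᵒᵖ] C where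
  toFun u := RegMod.val u • x.val
  map_add' u v := by rw [map_add, add_smul]
  map_smul' b u := by
    change (RegMod.val u * (b.unop : A)) • x.val = op (b.unop : A) • RegMod.val u • x.val
    rw [mul_smul, coinvRing_smul, smul_comm]

/-- `u ↦ f u`. -/
def dualOrbit (f : LeftDual A C) : RegMod x →ₗ[(coinvRing x)ᵐᵒᵖ] LeftDual A C where
  toFun u := LeftDual.mulRight f (RegMod.val u)
  map_add' u v := LeftDual.ext fun c => mul_add (f c) (RegMod.val u) (RegMod.val v)
  map_smul' b u := LeftDual.ext fun c => (mul_assoc (f c) (RegMod.val u) (b.unop : A)).symm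

/-- `q ↦ ∑ c₁ q(c₂) - q(c) x`. -/
def defect (c : C) : LeftDual A C →ₗ[(coinvRing x)ᵐᵒᵖ] C where
  toFun q := LeftDual.contract q c - q c • x.val
  map_add' p q := by
    rw [LeftDual.contract_add, LinearMap.add_apply, LeftDual.add_apply, add_smul]
    abel
  map_smul' b q := by
    change LeftDual.contract (LeftDual.mulRight q (b.unop : A)) c - (q c * (b.unop : A)) • x.val =
      op (b.unop : A) • (LeftDual.contract q c - q c • x.val)
    rw [LeftDual.contract_mulRight, smul_sub, mul_smul, coinvRing_smul, smul_comm (q c)]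

/-- `q ⊗ a ↦ q a` on `*C ⊗_B A`. -/
def dualMul : BalTensor (coinvRing x) (LeftDual A C) (RegMod x) →+ LeftDual A C :=
  lift (AddMonoidHom.mk' (fun q => AddMonoidHom.mk' (fun a => LeftDual.mulRight q (RegMod.val a))
        (fun a b => LeftDual.ext fun c => mul_add (q c) (RegMod.val a) (RegMod.val b)))
      (fun p q => by
        ext a
        exact LeftDual.ext fun c => add_mul (p c) (q c) (RegMod.val a)))
    (fun q b a => LeftDual.ext fun c => mul_assoc (q c) (b : A) (RegMod.val a))

/-- The endomorphism `f ⊗ id` of tensor products over `B` with `A`. -/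
abbrev tensorA {M M' : Type*} [AddCommGroup M] [Module (coinvRing x)ᵐᵒᵖ M] [AddCommGroup M']
    [Module (coinvRing x)ᵐᵒᵖ M'] (f : M →ₗ[(coinvRing x)ᵐᵒᵖ] M') :
    BalTensor (coinvRing x) M (RegMod x) →+ BalTensor (coinvRing x) M' (RegMod x) :=
  map f LinearMap.id

/-- On s = u ⊗ v both sides multiply f by u v, because ε(u x v) = u v. -/
theorem dualMul_dualOrbit (f : LeftDual A C)
    (s : BalTensor (coinvRing x) (RegMod x) (RegMod x)) :
    dualMul x (tensorA x (dualOrbit x f) s) =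
      LeftDual.mulRight f (Coring.counit (galoisMap x s)) := by
  induction s using BalTensor.induction_on with
  | tm u v =>
    refine LeftDual.ext fun c => ?_
    change f c * RegMod.val u * RegMod.val v =
      f c * Coring.counit (RegMod.val u • op (RegMod.val v) • x.val)
    rw [Coring.counit_smul, Coring.counit_op_smul, x.counit_val, one_mul, mul_assoc]
  | add s t hs ht =>
    rw [map_add, map_add, hs, ht, map_add, map_add]
    exact LeftDual.ext fun c => (mul_add _ _ _).symm

theorem galoisMap_leftMul (r : A) (s : BalTensor (coinvRing x) (RegMod x) (RegMod x)) :
    galoisMap x (tensorA x (leftMul x r) s) = r • galoisMap x s := by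
  induction s using BalTensor.induction_on with
  | tm u v => exact mul_smul r (RegMod.val u) _
  | add s t hs ht => rw [map_add, map_add, hs, ht, map_add, smul_add]

/-- Splits the defect into the two terms that are later compared through `transfer`. -/
theorem defect_dualOrbit (c : C) (f : LeftDual A C)
    (s : BalTensor (coinvRing x) (RegMod x) (RegMod x)) :
    tensorA x (defect x c) (tensorA x (dualOrbit x f) s) =
      tensorA x (orbit x (LeftDual.contract f c)) s -
        tensorA x (leftSMul x (f c)) (tensorA x (leftOrbit x) s) := by
  induction s using BalTensor.induction_on with
  | tm u v =>
    simp only [tensorA, map_tmul, LinearMap.id_apply]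
    rw [eq_sub_iff_add_eq, ← add_tmul]
    congr 1
    change LeftDual.contract (LeftDual.mulRight f (RegMod.val u)) c -
      (f c * RegMod.val u) • x.val + f c • RegMod.val u • x.val =
      op (RegMod.val u) • LeftDual.contract f c
    rw [LeftDual.contract_mulRight, mul_smul, sub_add_cancel]
  | add s t hs ht => simp only [map_add, hs, ht]; abel

section

variable (hx : IsGaloisExt x)

/-- The inverse of `β`. -/
noncomputable def galoisInv : C ≃+ BalTensor (coinvRing x) (RegMod x) (RegMod x) :=
  (AddEquiv.ofBijective (galoisMap x) hx).symm

theorem galoisMap_galoisInv (c : C) : galoisMap x (galoisInv x hx c) = c :=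
  (AddEquiv.ofBijective (galoisMap x) hx).apply_symm_apply c

theorem galoisInv_galoisMap (s : BalTensor (coinvRing x) (RegMod x) (RegMod x)) :
    galoisInv x hx (galoisMap x s) = s :=
  (AddEquiv.ofBijective (galoisMap x) hx).symm_apply_apply s

theorem galoisInv_smul (r : A) (c : C) :
    galoisInv x hx (r • c) = tensorA x (leftMul x r) (galoisInv x hx c) := by
  apply hx.1
  rw [galoisMap_galoisInv, galoisMap_leftMul, galoisMap_galoisInv]

/-- `c ⊗ d ↦ c β⁻¹(d)`, from `C ⊗_A C` to `C ⊗_B A`. -/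
noncomputable def transfer : BalTensor A C C →+ BalTensor (coinvRing x) C (RegMod x) :=
  lift (AddMonoidHom.mk' (fun c => (tensorA x (orbit x c)).comp (galoisInv x hx).toAddMonoidHom)
      (fun c c' => by
        ext d
        change tensorA x (orbit x (c + c')) (galoisInv x hx d) =
          tensorA x (orbit x c) (galoisInv x hx d) + tensorA x (orbit x c') (galoisInv x hx d)
        generalize galoisInv x hx d = s
        induction s using BalTensor.induction_on with
        | tm u v =>
          simp only [tensorA, map_tmul]
          rw [← add_tmul]
          exact congrArg (tmul _ · _) (smul_add (op (RegMod.val u)) c c')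
        | add s t hs ht => simp only [map_add, hs, ht]; abel))
    (fun c r d => by
      change tensorA x (orbit x (op r • c)) (galoisInv x hx d) =
        tensorA x (orbit x c) (galoisInv x hx (r • d))
      rw [galoisInv_smul]
      generalize galoisInv x hx d = s
      induction s using BalTensor.induction_on with
      | tm u v => exact congrArg (tmul _ · v) (mul_smul (op (RegMod.val u)) (op r) c).symm
      | add s t hs ht => simp only [map_add, hs, ht])

theorem transfer_tmul (c d : C) :
    transfer x hx (tmul A c d) = tensorA x (orbit x c) (galoisInv x hx d) := rfl

theorem transfer_smul (r : A) (t : BalTensor A C C) :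
    transfer x hx (r • t) = tensorA x (leftSMul x r) (transfer x hx t) := by
  induction t using BalTensor.induction_on with
  | tm c d =>
    rw [smul_tmul_left, transfer_tmul, transfer_tmul]
    generalize galoisInv x hx d = s
    induction s using BalTensor.induction_on with
    | tm u v => exact congrArg (tmul _ · v) (smul_comm r (op (RegMod.val u)) c).symm
    | add s t hs ht => simp only [map_add, hs, ht]
  | add s t hs ht => rw [smul_add, map_add, map_add, map_add, hs, ht]

/-- Δ(u x v) = u x ⊗ x v, and β⁻¹(x v) = 1 ⊗ v. -/
theorem tensorA_leftOrbit (s : BalTensor (coinvRing x) (RegMod x) (RegMod x)) :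
    tensorA x (leftOrbit x) s = transfer x hx (Coring.comul (galoisMap x s)) := by
  induction s using BalTensor.induction_on with
  | tm u v =>
    have h1 : galoisMap x (tmul _ (RegMod.val.symm 1) v) = op (RegMod.val v) • x.val :=
      one_smul A _
    change _ = transfer x hx (Coring.comul (RegMod.val u • op (RegMod.val v) • x.val))
    rw [Coring.comul_smul, Coring.comul_op_smul, x.comul_val, smul_tmul_right, smul_tmul_left,
      transfer_tmul, ← h1, galoisInv_galoisMap]
    refine congrArg (tmul _ · v) ?_
    change _ = op (1 : A) • RegMod.val u • x.val
    rw [op_one, one_smul]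
    rfl
  | add s t hs ht => simp only [map_add, hs, ht]

end

/-- Q is the kernel of the B-linear map δ collecting the defects. The element t = ∑ f_i β⁻¹(e_i) of
`*C` ⊗ A multiplies out to 1 and is killed by δ ⊗ A; by flatness it comes from Q ⊗ A. -/
theorem moritaF_surjective_of_isGaloisExt {κ : Type} [Fintype κ] (e : κ → C)
    (f : κ → LeftDual A C) (hef : ∀ c, ∑ i, f i c • e i = c)
    (hflat : IsFlat (coinvRing x) (RegMod x)) (hx : IsGaloisExt x) :
    Function.Surjective (moritaF x) := by
  -- Only the defects at the generators e_k are collected: the defect is left A-linear in c, and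
  -- vanishing in a finite power can be checked componentwise after tensoring.
  let δ : LeftDual A C →ₗ[(coinvRing x)ᵐᵒᵖ] (κ → C) := LinearMap.pi fun k => defect x (e k)
  let t : BalTensor (coinvRing x) (LeftDual A C) (RegMod x) :=
    ∑ i, tensorA x (dualOrbit x (f i)) (galoisInv x hx (e i))
  have ht : dualMul x t = 1 := by
    refine LeftDual.ext fun c => ?_
    rw [map_sum, LeftDual.sum_apply, LeftDual.one_apply]
    conv_rhs => rw [← hef c, map_sum]
    refine Finset.sum_congr rfl fun i _ => ?_
    rw [dualMul_dualOrbit, galoisMap_galoisInv, Coring.counit_smul]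
    rfl
  -- Both terms of the defect are the image of Δ(c) in C ⊗_B A: the first expands the right factor
  -- of Δ(c) in the dual basis, the second expands c itself.
  have hdefect : ∀ c, tensorA x (defect x c) t = 0 := fun c => by
    have h1 : ∑ i, tensorA x (orbit x (LeftDual.contract (f i) c)) (galoisInv x hx (e i)) =
        transfer x hx (Coring.comul c) := by
      rw [← LeftDual.sum_contract_tmul e f hef, map_sum]
      rfl
    have h2 : ∑ i, tensorA x (leftSMul x (f i c)) (tensorA x (leftOrbit x)
        (galoisInv x hx (e i))) = transfer x hx (Coring.comul c) := by
      conv_rhs => rw [← hef c, map_sum, map_sum]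
      refine Finset.sum_congr rfl fun i _ => ?_
      rw [tensorA_leftOrbit x hx, galoisMap_galoisInv, Coring.comul_smul, transfer_smul]
    rw [map_sum]
    simp only [defect_dualOrbit]
    rw [Finset.sum_sub_distrib, h1, h2, sub_self]
  have h0 : tensorA x δ t = 0 := by
    refine eq_zero_of_forall_map_proj _ fun k => ?_
    rw [← map_comp]
    exact hdefect (e k)
  obtain ⟨s, hs⟩ := hflat.exists_map_subtype_eq δ t h0
  obtain ⟨ι, _, q, a, rfl⟩ := exists_eq_sum s
  have hq : ∀ j, (q j : LeftDual A C) ∈ MoritaQ x := fun j c => by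
    have h1 : ∀ k, LeftDual.contract (q j).1 (e k) = (q j).1 (e k) • x.val := fun k =>
      sub_eq_zero.1 (congrFun (q j).2 k)
    rw [← hef c, map_sum, map_sum, Finset.sum_smul]
    refine Finset.sum_congr rfl fun k _ => ?_
    rw [map_smul, h1, map_smul, smul_eq_mul, mul_smul]
  refine moritaF_surjective_of_unit x (fun j => ⟨q j, hq j⟩) a ?_
  rw [← ht, ← hs, map_sum, map_sum]
  rfl

end GaloisDescent

end GroupLike

/-! ### Tensor identities in a dual basis -/

theorem BalTensor.eq_of_forall_rcontract_eq {R M N ι : Type*} [Ring R] [AddCommGroup M]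
    [Module Rᵐᵒᵖ M] [AddCommGroup N] [Module R N] [Fintype ι] (e : ι → N) (f : ι → N →ₗ[R] R)
    (h : ∀ n, ∑ i, f i n • e i = n) {s t : BalTensor R M N}
    (hst : ∀ i, rcontract (f i) s = rcontract (f i) t) : s = t := by
  rw [← sum_rcontract_tmul e f h s, ← sum_rcontract_tmul e f h t]
  exact Finset.sum_congr rfl fun i _ => by rw [hst]

theorem BalTensor.map_id_eq_sum {R M N W ι : Type*} [Ring R] [AddCommGroup M]
    [Module Rᵐᵒᵖ M] [AddCommGroup N] [Module R N] [AddCommGroup W] [Module R W] [Fintype ι]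
    (D : N →ₗ[R] W) (g : ι → N →ₗ[R] R) (w : ι → W) (h : ∀ n, D n = ∑ i, g i n • w i)
    (t : BalTensor R M N) :
    map (LinearMap.id : M →ₗ[Rᵐᵒᵖ] M) D t = ∑ i, tmul R (rcontract (g i) t) (w i) := by
  induction t using BalTensor.induction_on with
  | tm m n =>
    rw [map_tmul, h, tmul_sum]
    exact Finset.sum_congr rfl fun i _ => by rw [rcontract_tmul, smul_tmul]; rfl
  | add s t hs ht => simp only [map_add, hs, ht, add_tmul, Finset.sum_add_distrib]

section GroupLike

variable {A C : Type u} [Ring A] [AddCommGroup C] [Module A C] [Module Aᵐᵒᵖ C]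
  [SMulCommClass A Aᵐᵒᵖ C] [Coring A C]

/-! ### Comodules from modules over the left dual -/

/-- The ring homomorphism `A → *C`, `a ↦ [c ↦ ε(c) a]`. -/
def LeftDual.ofRing : A →+* LeftDual A C where
  toFun a := mulRight 1 a
  map_one' := ext fun c => mul_one _
  map_mul' a b := by
    rw [mul_mulRight_one]
    exact ext fun c => (mul_assoc _ a b).symm
  map_zero' := ext fun c => mul_zero _
  map_add' a b := ext fun c => mul_add _ a b

/-- A copy of the right `*C`-module `N`, considered as a right `A`-module along `A → *C`. -/
@[nolint unusedArguments]
def AsComodule (A C N : Type u) [Ring A] [AddCommGroup C] [Module A C] [Module Aᵐᵒᵖ C]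
    [SMulCommClass A Aᵐᵒᵖ C] [Coring A C] [AddCommGroup N] [Module (LeftDual A C)ᵐᵒᵖ N] :
    Type u := N

namespace AsComodule

variable {N : Type u} [AddCommGroup N] [Module (LeftDual A C)ᵐᵒᵖ N]

instance instAddCommGroup : AddCommGroup (AsComodule A C N) := inferInstanceAs (AddCommGroup N)

instance instModuleDual : Module (LeftDual A C)ᵐᵒᵖ (AsComodule A C N) :=
  inferInstanceAs (Module (LeftDual A C)ᵐᵒᵖ N)

instance instModule : Module Aᵐᵒᵖ (AsComodule A C N) :=
  Module.compHom (AsComodule A C N) (RingHom.op (LeftDual.ofRing (A := A) (C := C)))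

theorem op_smul_def (a : A) (n : AsComodule A C N) :
    op a • n = op (LeftDual.ofRing a : LeftDual A C) • n := rfl

/-- Right multiplication by r on C corresponds to left multiplication by the image of r in `*C`. -/
theorem rcontract_op_smul (g : LeftDual A C) (r : A) (t : BalTensor A (AsComodule A C N) C) :
    rcontract (LeftDual.toLin g) (op r • t) =
      rcontract (LeftDual.toLin (LeftDual.ofRing r * g)) t := by
  induction t using BalTensor.induction_on with
  | tm n c =>
    rw [smul_tmul_right, rcontract_tmul, rcontract_tmul]
    congr 2
    exact (LeftDual.mulRight_one_mul g r c).symm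
  | add s t hs ht => rw [smul_add, map_add, hs, ht, map_add]

variable {κ : Type*} [Fintype κ] (e : κ → C) (f : κ → LeftDual A C)

/-- The coaction `n ↦ ∑ n fᵢ ⊗ eᵢ`, as an additive map. -/
def coactAux : AsComodule A C N →+ BalTensor A (AsComodule A C N) C :=
  AddMonoidHom.mk' (fun n => ∑ i, tmul A (op (f i) • n) (e i)) (fun m n => by
    rw [← Finset.sum_add_distrib]
    exact Finset.sum_congr rfl fun i _ => by rw [smul_add, add_tmul])

variable {e f} (hef : ∀ c, ∑ i, f i c • e i = c)

include hef in
-- The identity g = ∑ f_i g(e_i) in `*C` shows that the coaction recovers the action of g.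
theorem rcontract_coactAux (g : LeftDual A C) (n : AsComodule A C N) :
    rcontract (LeftDual.toLin g) (coactAux e f n) = op g • n := by
  have h : ∑ i, f i * LeftDual.ofRing (g (e i)) = g := LeftDual.ext fun c => by
    rw [LeftDual.sum_apply]
    conv_rhs => rw [← hef c, map_sum]
    refine Finset.sum_congr rfl fun i _ => ?_
    rw [LeftDual.map_smul']
    exact congrArg (fun q : LeftDual A C => q c) (LeftDual.mul_mulRight_one (f i) (g (e i)))
  conv_rhs => rw [← h, Finset.op_sum, Finset.sum_smul]
  refine (map_sum (rcontract (LeftDual.toLin g) : BalTensor A (AsComodule A C N) C →+ _)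
    (fun i => tmul A (op (f i) • n) (e i)) _).trans ?_
  refine Finset.sum_congr rfl fun i _ => ?_
  rw [rcontract_tmul, op_smul_def, op_mul, mul_smul]

/-- The coaction `n ↦ ∑ n fᵢ ⊗ eᵢ`. -/
def coact : AsComodule A C N →ₗ[Aᵐᵒᵖ] BalTensor A (AsComodule A C N) C where
  toFun := coactAux e f
  map_add' := map_add _
  map_smul' r n := by
    obtain ⟨r, rfl⟩ := op_surjective r
    refine eq_of_forall_rcontract_eq e (fun i => LeftDual.toLin (f i)) hef fun i => ?_
    rw [RingHom.id_apply, rcontract_op_smul, rcontract_coactAux hef, rcontract_coactAux hef,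
      op_mul, mul_smul, op_smul_def]

theorem coact_apply (n : AsComodule A C N) :
    coact hef n = ∑ i, tmul A (op (f i) • n) (e i) := rfl

theorem rcontract_coact (g : LeftDual A C) (n : AsComodule A C N) :
    rcontract (LeftDual.toLin g) (coact hef n) = op g • n := rcontract_coactAux hef g n

/-- The comodule structure on a right `*C`-module, when `C` has a finite dual basis. -/
@[reducible] def rightComodule : RightComodule A C (AsComodule A C N) where
  coact := coact hef
  coassoc n := by
    -- The coefficients of Δ in the dual basis are products in `*C`, so coassociativity reduces to n
    -- (f_k f_l) = (n f_k) f_l.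
    have hΔ : ∀ c, Coring.comulₗ A C c = ∑ p : κ × κ, LeftDual.toLin (f p.1 * f p.2) c •
        tmul A (e p.2) (e p.1) := fun c => by
      refine (LeftDual.sum_contract_tmul e f hef c).symm.trans ?_
      rw [Fintype.sum_prod_type]
      refine Finset.sum_congr rfl fun k _ => ?_
      conv_lhs => rw [← hef (LeftDual.contract (f k) c), sum_tmul]
      rfl
    rw [map_id_eq_sum (Coring.comulₗ A C) _ _ hΔ]
    simp only [rcontract_coact]
    rw [Fintype.sum_prod_type, coact_apply, map_sum, map_sum]
    refine Finset.sum_congr rfl fun k _ => ?_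
    rw [map_tmul, assoc_tmul, coact_apply, map_sum]
    refine Finset.sum_congr rfl fun l _ => ?_
    rw [assocAux_tmul, op_mul, mul_smul]
    rfl
  counit n := (rcontract_coact hef 1 n).trans (one_smul (LeftDual A C)ᵐᵒᵖ n)

end AsComodule

variable (x : GroupLikeElem A C)

theorem RegMod.one_dual_smul (g : LeftDual A C) (a : RegMod x) :
    op (g (op (RegMod.val a) • x.val)) • (RegMod.val.symm 1 : RegMod x) = op g • a :=
  one_mul (g (op (RegMod.val a) • x.val))

theorem RegMod.ofRing_smul (r : A) (a : RegMod x) :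
    op (LeftDual.ofRing r : LeftDual A C) • a = op r • a := by
  change Coring.counit (op (RegMod.val a) • x.val) * r = RegMod.val a * r
  rw [Coring.counit_op_smul, x.counit_val, one_mul]

/-! ### Colinear maps and maps linear over the left dual -/

section

variable {N : Type u} [AddCommGroup N] [Module (LeftDual A C)ᵐᵒᵖ N]
  {κ : Type*} [Fintype κ] {e : κ → C} {f : κ → LeftDual A C} (hef : ∀ c, ∑ i, f i c • e i = c)

/-- Colinear maps are right `*C`-linear. -/
def colinearToDual : letI := AsComodule.rightComodule (N := N) hef
    ColinearHom A C (RegMod x) (AsComodule A C N) → RegMod x →ₗ[(LeftDual A C)ᵐᵒᵖ] N :=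
  letI := AsComodule.rightComodule (N := N) hef
  fun φ =>
  { toFun := fun a => φ.1 a
    map_add' := map_add φ.1
    map_smul' := fun g a => by
      obtain ⟨g, rfl⟩ := op_surjective g
      -- Contracting the colinearity of φ with g compares φ(a) g with φ(1) g(x a) = φ(a ↼ g).
      have h := AsComodule.rcontract_coact hef g (φ.1 a)
      have hφ : AsComodule.coact hef (φ.1 a) = BalTensor.map (R := A) φ.1 LinearMap.id
        (RightComodule.coact (A := A) (C := C) a) := φ.2 a
      rw [hφ, rcontract_map] at h
      rw [← RegMod.one_dual_smul]
      exact h }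

/-- Right `*C`-linear maps are colinear. -/
def colinearOfDual : letI := AsComodule.rightComodule (N := N) hef
    DualHom x N →ₗ[(coinvRing x)ᵐᵒᵖ] ColinearHom A C (RegMod x) (AsComodule A C N) :=
  letI := AsComodule.rightComodule (N := N) hef
  { toFun := fun φ => ⟨
      { toFun := fun a => DualHom.lin φ a
        map_add' := map_add (DualHom.lin φ)
        map_smul' := fun r a => by
          obtain ⟨r, rfl⟩ := op_surjective r
          rw [← RegMod.ofRing_smul]
          exact map_smul (DualHom.lin φ) _ a },
      fun a => by
        refine eq_of_forall_rcontract_eq e (fun i => LeftDual.toLin (f i)) hef fun i => ?_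
        rw [rcontract_map]
        refine (AsComodule.rcontract_coact hef (f i) _).trans ?_
        refine (map_smul (DualHom.lin φ) _ a).symm.trans ?_
        rw [← RegMod.one_dual_smul]
        rfl⟩
    map_add' := fun φ ψ => rfl
    map_smul' := fun b φ => rfl }

/-- The evaluation `Hom_{-*C}(A, N) ⊗_B A → N`. -/
def dualEval (N : Type u) [AddCommGroup N] [Module (LeftDual A C)ᵐᵒᵖ N] :
    BalTensor (coinvRing x) (DualHom x N) (RegMod x) →+ N :=
  lift (AddMonoidHom.mk' (fun φ => (DualHom.lin φ).toAddMonoidHom) (fun φ ψ => by ext a; rfl))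
    (fun φ b a => rfl)

theorem dualEval_postcomp {N' : Type u} [AddCommGroup N'] [Module (LeftDual A C)ᵐᵒᵖ N']
    (p : N →ₗ[(LeftDual A C)ᵐᵒᵖ] N') (t : BalTensor (coinvRing x) (DualHom x N) (RegMod x)) :
    dualEval x N' (map (R := coinvRing x) (DualHom.postcomp x p) LinearMap.id t) =
      p (dualEval x N t) := by
  induction t using BalTensor.induction_on with
  | tm φ a => rfl
  | add s t hs ht => simp only [map_add, hs, ht]

include hef

theorem isGenerated_of_surjective_Psi' (h : letI := AsComodule.rightComodule (N := N) hef
    Function.Surjective (Psi' x (AsComodule A C N))) :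
    IsGenerated (LeftDual A C)ᵐᵒᵖ (RegMod x) N := by
  let _ := AsComodule.rightComodule (N := N) hef
  refine isGenerated_of_forall_exists_sum fun n => ?_
  obtain ⟨t, ht⟩ := h n
  obtain ⟨ι, _, φ, a, rfl⟩ := exists_eq_sum t
  refine ⟨ι, ‹_›, fun i => colinearToDual x hef (φ i), a, ?_⟩
  rw [← ht, map_sum]
  rfl

theorem isComoduleGenerated_of_isGenerated (h : IsGenerated (LeftDual A C)ᵐᵒᵖ (RegMod x) N) :
    letI := AsComodule.rightComodule (N := N) hef
    IsComoduleGenerated x (AsComodule A C N) := by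
  let _ := AsComodule.rightComodule (N := N) hef
  obtain ⟨I, F, hF⟩ := h
  refine ⟨I, fun i => colinearOfDual x hef (DualHom.lin.symm (F.comp (Finsupp.lsingle i))),
    fun n => ?_⟩
  obtain ⟨a, rfl⟩ := hF n
  refine ⟨a, ?_⟩
  conv_rhs => rw [← Finsupp.sum_single a, Finsupp.sum, map_sum]
  rfl

/-- Evaluation is Ψ' after the passage from linear to colinear maps, and that passage has a left
inverse which survives tensoring. -/
theorem injective_dualEval_of_injective_Psi' (h : letI := AsComodule.rightComodule (N := N) hef
    Function.Injective (Psi' x (AsComodule A C N))) : Function.Injective (dualEval x N) := by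
  let _ := AsComodule.rightComodule (N := N) hef
  let toDual : ColinearHom A C (RegMod x) (AsComodule A C N) →ₗ[(coinvRing x)ᵐᵒᵖ] DualHom x N :=
    { toFun := fun φ => DualHom.lin.symm (colinearToDual x hef φ)
      map_add' := fun φ ψ => rfl
      map_smul' := fun b φ => rfl }
  have h1 : ∀ t, Psi' x (AsComodule A C N)
      (map (R := coinvRing x) (colinearOfDual x hef) LinearMap.id t) = dualEval x N t := fun t => by
    induction t using BalTensor.induction_on with
    | tm φ a => rfl
    | add s t hs ht =>
      rw [map_add, map_add, hs, ht]
      exact (map_add (dualEval x N) s t).symm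
  have h2 : ∀ t, map (R := coinvRing x) toDual LinearMap.id
      (map (R := coinvRing x) (colinearOfDual x hef) LinearMap.id t) =
      (t : BalTensor (coinvRing x) (DualHom x N) (RegMod x)) := fun t => by
    induction t using BalTensor.induction_on with
    | tm φ a => rfl
    | add s t hs ht => simp only [map_add, hs, ht]
  intro s t hst
  rw [← h2 s, h ((h1 s).trans (hst.trans (h1 t).symm)), h2]

end

/-! ### From subgenerator to generator; fullness -/

/-- Embed M in a generated N and write m = ∑ φ_i(a_i) there. The tensor ∑ φ_i ⊗ a_i evaluates to
zero in N/M, which is again generated, so it vanishes in Hom(A, N/M) ⊗ A. By flatness it comes from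
maps A → N that vanish modulo M, that is, from maps A → M. -/
theorem isGenerator_of_injective_dualEval (hflat : IsFlat (coinvRing x) (RegMod x))
    (hsub : IsSubgenerator (LeftDual A C)ᵐᵒᵖ (RegMod x))
    (hinj : ∀ (N : Type u) [AddCommGroup N] [Module (LeftDual A C)ᵐᵒᵖ N],
      IsGenerated (LeftDual A C)ᵐᵒᵖ (RegMod x) N → Function.Injective (dualEval x N)) :
    IsGenerator (LeftDual A C)ᵐᵒᵖ (RegMod x) := by
  intro M _ _
  obtain ⟨N, _, _, hN, j, hj⟩ := hsub M
  refine isGenerated_of_forall_exists_sum fun m => ?_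
  obtain ⟨ι, _, φ, a, hm⟩ := hN.exists_sum (j m)
  have hN' : IsGenerated (LeftDual A C)ᵐᵒᵖ (RegMod x) (N ⧸ LinearMap.range j) := by
    obtain ⟨I, F, hF⟩ := hN
    exact ⟨I, (LinearMap.range j).mkQ.comp F, (Submodule.mkQ_surjective _).comp hF⟩
  let t : BalTensor (coinvRing x) (DualHom x N) (RegMod x) :=
    ∑ i, tmul _ (DualHom.lin.symm (φ i)) (a i)
  have ht : dualEval x N t = j m := by rw [hm, map_sum]; rfl
  obtain ⟨s, hs⟩ := hflat.exists_map_subtype_eq (DualHom.postcomp x (LinearMap.range j).mkQ) t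
    (hinj _ hN' (by
      rw [dualEval_postcomp, ht, map_zero, Submodule.mkQ_apply, Submodule.Quotient.mk_eq_zero]
      exact LinearMap.mem_range_self j m))
  obtain ⟨ι', _, ψ, b, rfl⟩ := exists_eq_sum s
  have hψ : ∀ i a, DualHom.lin (ψ i).1 a ∈ LinearMap.range j := fun i a =>
    (Submodule.Quotient.mk_eq_zero _).1
      (LinearMap.congr_fun (congrArg DualHom.lin (ψ i).2) a)
  refine ⟨ι', ‹_›, fun i => (LinearEquiv.ofInjective j hj).symm.toLinearMap.comp
    (LinearMap.codRestrict _ (DualHom.lin (ψ i).1) (hψ i)), b, hj ?_⟩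
  rw [← ht, ← hs, map_sum, map_sum, map_sum]
  refine Finset.sum_congr rfl fun i _ => ?_
  exact (LinearEquiv.ofInjective_symm_apply (h := hj) j ⟨_, hψ i (b i)⟩).symm

open CategoryTheory

/-- The module Hom(A, N) ⊗ A is itself generated. Fullness therefore lifts the unit φ ↦ φ ⊗ (-) to a
linear map from N to it, and this lift is a left inverse of evaluation. -/
theorem injective_dualEval_of_full [(genHomFunctor x).Full] (N : Type u) [AddCommGroup N]
    [Module (LeftDual A C)ᵐᵒᵖ N] (hN : IsGenerated (LeftDual A C)ᵐᵒᵖ (RegMod x) N) :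
    Function.Injective (dualEval x N) := by
  let unitHom : DualHom x N → RegMod x →ₗ[(LeftDual A C)ᵐᵒᵖ]
      BalTensor (coinvRing x) (DualHom x N) (RegMod x) := fun φ =>
    { toFun := fun a => tmul _ φ a
      map_add' := tmul_add _ φ
      map_smul' := fun g a => rfl }
  have hT : IsGenerated (LeftDual A C)ᵐᵒᵖ (RegMod x)
      (BalTensor (coinvRing x) (DualHom x N) (RegMod x)) := by
    refine isGenerated_of_forall_exists_sum fun t => ?_
    obtain ⟨ι, _, φ, a, rfl⟩ := exists_eq_sum t
    exact ⟨ι, ‹_›, fun i => unitHom (φ i), a, rfl⟩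
  let η : DualHom x N →ₗ[(coinvRing x)ᵐᵒᵖ]
      DualHom x (BalTensor (coinvRing x) (DualHom x N) (RegMod x)) :=
    { toFun := fun φ => DualHom.lin.symm (unitHom φ)
      map_add' := fun φ ψ => DualHom.lin.injective (LinearMap.ext fun a => add_tmul _ φ ψ a)
      map_smul' := fun b φ => DualHom.lin.injective
        (LinearMap.ext fun a => smul_tmul _ φ b.unop a) }
  let X : (genProperty x).FullSubcategory := ⟨ModuleCat.of _ N, hN⟩
  let Y : (genProperty x).FullSubcategory :=
    ⟨ModuleCat.of _ (BalTensor (coinvRing x) (DualHom x N) (RegMod x)), hT⟩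
  let η' : (genHomFunctor x).obj X ⟶ (genHomFunctor x).obj Y := ModuleCat.ofHom η
  obtain ⟨s, hs⟩ := (genHomFunctor x).map_surjective η'
  have h1 : ∀ t, s.hom.hom (dualEval x N t) = t := fun t => by
    induction t using BalTensor.induction_on with
    | tm φ a =>
      exact LinearMap.congr_fun (congrArg DualHom.lin
        (LinearMap.congr_fun (congrArg ModuleCat.Hom.hom hs) φ)) a
    | add t t' h h' => rw [map_add, map_add, h, h']
  exact Function.LeftInverse.injective h1

theorem exists_postcomp_eq_of_unit {ι : Type*} [Fintype ι] {q : ι → MoritaQ x}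
    {a : ι → RegMod x} (h : ∑ j, moritaF x (tmul _ (q j) (a j)) = 1)
    {M N : Type u} [AddCommGroup M] [Module (LeftDual A C)ᵐᵒᵖ M] [AddCommGroup N]
    [Module (LeftDual A C)ᵐᵒᵖ N] (θ : DualHom x M →ₗ[(coinvRing x)ᵐᵒᵖ] DualHom x N) :
    ∃ φ : M →ₗ[(LeftDual A C)ᵐᵒᵖ] N, DualHom.postcomp x φ = θ := by
  -- The formula is forced: m = ∑ (m q_j) a_j is a sum of values at a_j of the maps a ↦ m (q_j a),
  -- to which θ applies.
  let F : M →+ N := AddMonoidHom.mk'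
    (fun m => ∑ j, DualHom.lin (θ (DualHom.lin.symm (moritaHom x (q j) M m))) (a j))
    (fun m m' => by
      rw [← Finset.sum_add_distrib]
      refine Finset.sum_congr rfl fun j _ => ?_
      have h1 : (DualHom.lin.symm (moritaHom x (q j) M (m + m')) : DualHom x M) =
          DualHom.lin.symm (moritaHom x (q j) M m) + DualHom.lin.symm (moritaHom x (q j) M m') :=
        DualHom.lin.injective (LinearMap.ext fun b => smul_add _ m m')
      rw [h1, map_add]
      rfl)
  have hF : ∀ (ψ : DualHom x M) (b : RegMod x), F (DualHom.lin ψ b) = DualHom.lin (θ ψ) b :=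
    fun ψ b => by
      conv_rhs => rw [← sum_moritaG_smul x h b, map_sum]
      refine Finset.sum_congr rfl fun j _ => ?_
      have h1 : (DualHom.lin.symm (moritaHom x (q j) M (DualHom.lin ψ b)) : DualHom x M) =
          op (moritaG x b (q j)) • ψ :=
        DualHom.lin.injective (LinearMap.ext fun c => (map_smul (DualHom.lin ψ)
          (op (moritaF x (tmul _ (q j) c))) b).symm)
      rw [h1, map_smul]
      rfl
  refine ⟨{ F with map_smul' := fun g m => ?_ },
    LinearMap.ext fun ψ => DualHom.lin.injective (LinearMap.ext fun b => hF ψ b)⟩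
  -- M is generated by A, so linearity over `*C` need only be checked on values ψ(b), where `hF`
  -- computes F.
  obtain ⟨κ, _, ψ, b, rfl⟩ := (isGenerator_of_moritaF_surjective x
    (moritaF_surjective_of_unit x q a h) M).exists_sum m
  change F _ = g • F _
  rw [Finset.smul_sum, map_sum, map_sum, Finset.smul_sum]
  refine Finset.sum_congr rfl fun i _ => ?_
  rw [← map_smul]
  refine (hF (DualHom.lin.symm (ψ i)) (g • b i)).trans ?_
  rw [map_smul, ← hF]
  rfl

theorem full_genHomFunctor_of_unit {ι : Type*} [Fintype ι] {q : ι → MoritaQ x}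
    {a : ι → RegMod x} (h : ∑ j, moritaF x (tmul _ (q j) (a j)) = 1) :
    (genHomFunctor x).Full := by
  refine ⟨fun {X Y} θ => ?_⟩
  obtain ⟨φ, hφ⟩ := exists_postcomp_eq_of_unit x h (M := X.obj) (N := Y.obj) θ.hom
  exact ⟨ObjectProperty.homMk (ModuleCat.ofHom φ), ModuleCat.hom_ext hφ⟩

theorem faithful_genHomFunctor (h : (homFunctor x).Faithful) : (genHomFunctor x).Faithful := by
  unfold genHomFunctor
  infer_instance

end GroupLike

end CoringTheory

/-! ### The equivalences -/

theorem mainTheorem6 {A C : Type u} [Ring A] [AddCommGroup C] [Module A C] [Module Aᵐᵒᵖ C]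
    [SMulCommClass A Aᵐᵒᵖ C] [Coring A C] (x : GroupLikeElem A C)
    (hfin : Module.Finite A C) (hproj : Module.Projective A C) :
    List.TFAE
      [ WeakStructureTheorem x,
        IsFlat (coinvRing x) (RegMod x) ∧ IsGaloisExt x,
        IsFlat (coinvRing x) (RegMod x) ∧ Function.Bijective (Psi' x C),
        IsFlat (coinvRing x) (RegMod x) ∧ IsSubgenerator (LeftDual A C)ᵐᵒᵖ (RegMod x) ∧
          ∀ (M : Type u) [AddCommGroup M] [Module Aᵐᵒᵖ M] [RightComodule A C M],
            IsComoduleGenerated x M → Function.Bijective (Psi' x M),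
        ∀ (M : Type u) [AddCommGroup M] [Module Aᵐᵒᵖ M] [RightComodule A C M],
          Function.Bijective (Psi' x M),
        IsFlat (coinvRing x) (RegMod x) ∧ IsSubgenerator (LeftDual A C)ᵐᵒᵖ (RegMod x) ∧
          (genHomFunctor x).Full ∧ (genHomFunctor x).Faithful,
        (homFunctor x).Faithful,
        IsGenerator (LeftDual A C)ᵐᵒᵖ (RegMod x),
        Function.Surjective (moritaF x),
        Function.Bijective (moritaF x),
        (Module.Finite (coinvRing x)ᵐᵒᵖ (MoritaQ x) ∧
            Module.Projective (coinvRing x)ᵐᵒᵖ (MoritaQ x)) ∧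
          IsBimoduleIsoOmega x ∧ FaithfulSMul (LeftDual A C) (MoritaQ x),
        (Module.Finite (coinvRing x) (RegMod x) ∧ Module.Projective (coinvRing x) (RegMod x)) ∧
          Function.Bijective (Lambda x) ] := by
  obtain ⟨n, e, f, hef⟩ := exists_dualBasis A C
  let f' : Fin n → LeftDual A C := f
  change ∀ c, ∑ i, f' i c • e i = c at hef
  have h98 : Function.Surjective (moritaF x) → IsGenerator (LeftDual A C)ᵐᵒᵖ (RegMod x) :=
    isGenerator_of_moritaF_surjective x
  have h91 : Function.Surjective (moritaF x) → WeakStructureTheorem x := fun h M _ _ _ => by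
    obtain ⟨ι, _, q, a, h⟩ := exists_unit_of_moritaF_surjective x h
    exact bijective_Psi_of_unit x M h
  have hflat : Function.Surjective (moritaF x) → IsFlat (coinvRing x) (RegMod x) := fun h => by
    obtain ⟨ι, _, q, a, h⟩ := exists_unit_of_moritaF_surjective x h
    exact isFlat_regMod_of_unit x h
  have hsub : Function.Surjective (moritaF x) →
      IsSubgenerator (LeftDual A C)ᵐᵒᵖ (RegMod x) := fun h M _ _ =>
    ⟨M, _, _, h98 h M, LinearMap.id, Function.injective_id⟩
  tfae_have 1 ↔ 5 := ⟨fun h M _ _ _ => (bijective_Psi'_iff x M).2 (h M),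
    fun h M _ _ _ => (bijective_Psi'_iff x M).1 (h M)⟩
  tfae_have 2 ↔ 3 := and_congr_right' ((bijective_Psi_self_iff x).symm.trans
    (bijective_Psi'_iff x C).symm)
  tfae_have 2 → 9 := fun h =>
    GaloisDescent.moritaF_surjective_of_isGaloisExt x e f' hef h.1 h.2
  tfae_have 9 → 2 := fun h => ⟨hflat h, (bijective_Psi_self_iff x).1 (h91 h C)⟩
  tfae_have 9 → 1 := h91
  tfae_have 5 → 8 := fun h M _ _ => by
    let _ := AsComodule.rightComodule (N := M) hef
    exact isGenerated_of_surjective_Psi' x hef (h (AsComodule A C M)).2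
  tfae_have 8 → 9 := moritaF_surjective_of_isGenerator x e f' hef
  tfae_have 9 → 4 := fun h => ⟨hflat h, hsub h, fun M _ _ _ _ =>
    (bijective_Psi'_iff x M).2 (h91 h M)⟩
  tfae_have 4 → 8 := fun ⟨h1, h2, h3⟩ =>
    isGenerator_of_injective_dualEval x h1 h2 fun N _ _ hN => by
      let _ := AsComodule.rightComodule (N := N) hef
      exact injective_dualEval_of_injective_Psi' x hef
        (h3 (AsComodule A C N) (isComoduleGenerated_of_isGenerated x hef hN)).1
  tfae_have 7 → 8 := isGenerator_of_faithful_homFunctor x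
  tfae_have 8 → 7 := faithful_homFunctor_of_isGenerator x
  tfae_have 9 → 6 := fun h => by
    obtain ⟨ι, _, q, a, hu⟩ := exists_unit_of_moritaF_surjective x h
    exact ⟨hflat h, hsub h, full_genHomFunctor_of_unit x hu,
      faithful_genHomFunctor x (faithful_homFunctor_of_isGenerator x (h98 h))⟩
  tfae_have 6 → 8 := fun ⟨h1, h2, _, _⟩ =>
    isGenerator_of_injective_dualEval x h1 h2 fun N _ _ hN => injective_dualEval_of_full x N hN
  tfae_have 9 → 10 := fun h => by
    obtain ⟨ι, _, q, a, hu⟩ := exists_unit_of_moritaF_surjective x h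
    exact ⟨moritaF_injective_of_unit x hu, h⟩
  tfae_have 10 → 9 := fun h => h.2
  tfae_have 9 → 11 := fun h => by
    obtain ⟨ι, _, q, a, hu⟩ := exists_unit_of_moritaF_surjective x h
    exact ⟨⟨finite_moritaQ_of_unit x hu, projective_moritaQ_of_unit x hu⟩,
      isBimoduleIsoOmega_of_bijective x (bijective_Omega_of_unit x hu),
      faithful_moritaQ_of_unit x hu⟩
  tfae_have 11 → 9 := fun ⟨⟨_, _⟩, h, _⟩ => moritaF_surjective_of_bijective_Omega x h.1
  tfae_have 9 → 12 := fun h => by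
    obtain ⟨ι, _, q, a, hu⟩ := exists_unit_of_moritaF_surjective x h
    exact ⟨⟨finite_regMod_of_unit x hu, projective_regMod_of_unit x hu⟩,
      bijective_Lambda_of_unit x hu⟩
  tfae_have 12 → 9 := fun ⟨⟨_, _⟩, h⟩ => moritaF_surjective_of_bijective_Lambda x e f' hef h
  tfae_finish
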